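/- Let $N\ge 2$ be an integer and let $\ell$ be an integer relatively prime to $N$. For a lattice $L\subset\mathbb C$ and $u\in N^{-1}L$ put $$\Phi(L,u,s)=\sum_{\omega\ne 0,\ \omega/N\equiv u \bmod L}\omega^{-1}|\omega|^{-s}\qquad(\operatorname{Re} s>1).$$ The series converges absolutely and has an analytic continuation to a half-plane containing $s=0$; let $G(L,u)=\Phi(L,u,0)$ be the value of the continuation. For $u,v\in N^{-1}L$ let $\chi^L_u(v)=\exp\bigl(2\pi i N\,(u\wedge v)/\alpha_L\bigr)$, where $\alpha_L$ is the generator of $\bigwedge^2_{\mathbb Z}L$ which is a positive multiple of $1\wedge i\in\bigwedge^2_{\mathbb R}\mathbb C$, and let $$G'(L,u)=\sum_{w\in N^{-1}L/L}\chi^L_u(w)\,G(L,w).$$ For $\tau$ in the upper half plane put $L_\tau=\mathbb Z\cdot 2\pi i+\mathbb Z\cdot 2\pi i\tau$ and $q^{n/N}=e^{2\pi i n\tau/N}$. Let $\{x\}=x-\lfloor x\rfloor$ denote the fractional part, so that $\{\ell/N\}=\ell/N$ if $0<\ell<N$. Below, $m$ runs over all integers, positive or negative, that divide $n$ and are congruent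 to $\ell$ modulo $N$. Then, for every $\tau$ in the upper half plane and with absolutely convergent series, the following hold. (a) $$G'\Bigl(L_\tau,\,2\pi i\,\frac{\ell\tau}{N}\Bigr)=\Bigl(\Bigl\{\frac{\ell}{N}\Bigr\}-\frac12\Bigr)-\sum_{n=1}^\infty\Bigl(\sum_{m\mid n,\ m\equiv \ell}\operatorname{sgn} m\Bigr)q^{n/N}.$$ (b) If $N$ is even, then $$G'\Bigl(L_\tau,\,2\pi i\Bigl(\frac12+\frac{\ell\tau}{N}\Bigr)\Bigr)=\Bigl(\Bigl\{\frac{\ell}{N}\Bigr\}-\frac12\Bigr)-\sum_{n=1}^\infty\Bigl(\sum_{m\mid n,\ m\equiv \ell}(-1)^{n/m}\operatorname{sgn} m\Bigr)q^{n/N}.$$ In particular, the expansion at the cusp $\tau=0$ of the weight one form $f(\tau)=G'(L_\tau,2\pi i\ell/N)$ has rational coefficients: there are rational numbers $c_0,c_1,\dots$ such that $\tau^{-1}f(-1/\tau)=\sum_{n\ge 0}c_n q^{n/N}$ for all $\tau$ in the upper half plane. -/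

import Mathlib

open scoped UpperHalfPlane

noncomputable section

namespace HeckeEisenstein

/-- The lattice `ℤ·2πi + ℤ·2πiτ`. -/
def tateLattice (τ : ℂ) : Submodule ℤ ℂ :=
  Submodule.span ℤ {2 * (Real.pi : ℂ) * Complex.I, 2 * (Real.pi : ℂ) * Complex.I * τ}

/-- The index set of Hecke's series: all `ω ≠ 0` with `ω / N ≡ u mod L`. -/
def HeckeIndex (N : ℕ) (L : Submodule ℤ ℂ) (u : ℂ) : Set ℂ :=
  {ω | ω ≠ 0 ∧ ω / (N : ℂ) - u ∈ L}

/-- `F` is an analytic continuation of `Φ(L, u, s) = ∑' ω⁻¹ |ω|⁻ˢ` (the sum being over the nonzero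
`ω` with `ω / N ≡ u mod L`) from its half-plane of absolute convergence `Re s > 1` to some
half-plane `Re s > σ` that contains the point `s = 0`. -/
def IsHeckeContinuation (N : ℕ) (L : Submodule ℤ ℂ) (u : ℂ) (F : ℂ → ℂ) : Prop :=
  ∃ σ : ℝ, σ < 0 ∧ DifferentiableOn ℂ F {s | σ < s.re} ∧
    ∀ s : ℂ, 1 < s.re →
      HasSum (fun ω : HeckeIndex N L u => (ω : ℂ)⁻¹ * ((‖(ω : ℂ)‖ : ℝ) : ℂ) ^ (-s)) (F s)

open Classical in
/-- Hecke's `G(L, u) = Φ(L, u, 0)`, the value at `s = 0` of the analytic continuation. -/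
def heckeG (N : ℕ) (L : Submodule ℤ ℂ) (u : ℂ) : ℂ :=
  if h : ∃ F, IsHeckeContinuation N L u F then h.choose 0 else 0

/-- Any two continuations agree at `0`, so `heckeG` does not depend on a choice. -/
theorem IsHeckeContinuation.heckeG_eq {N : ℕ} {L : Submodule ℤ ℂ} {u : ℂ} {F : ℂ → ℂ}
    (hF : IsHeckeContinuation N L u F) : heckeG N L u = F 0 := by
  have h : ∃ F, IsHeckeContinuation N L u F := ⟨F, hF⟩
  rw [heckeG, dif_pos h]
  obtain ⟨σ₁, h₁, d₁, s₁⟩ := h.choose_spec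
  obtain ⟨σ₂, h₂, d₂, s₂⟩ := hF
  have ho : IsOpen {s : ℂ | max σ₁ σ₂ < s.re} := isOpen_lt continuous_const Complex.continuous_re
  have hc : IsPreconnected {s : ℂ | max σ₁ σ₂ < s.re} :=
    (convex_halfSpace_re_gt (max σ₁ σ₂)).isPreconnected
  have a₁ : AnalyticOnNhd ℂ h.choose {s : ℂ | max σ₁ σ₂ < s.re} :=
    (d₁.mono fun (s : ℂ) (hs : max σ₁ σ₂ < s.re) =>
      show _ < s.re from lt_of_le_of_lt (le_max_left _ _) hs).analyticOnNhd ho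
  have a₂ : AnalyticOnNhd ℂ F {s : ℂ | max σ₁ σ₂ < s.re} :=
    (d₂.mono fun (s : ℂ) (hs : max σ₁ σ₂ < s.re) =>
      show _ < s.re from lt_of_le_of_lt (le_max_right _ _) hs).analyticOnNhd ho
  have hm : max σ₁ σ₂ < 0 := max_lt h₁ h₂
  refine a₁.eqOn_of_preconnected_of_eventuallyEq a₂ hc (z₀ := 2) ?_ ?_ (by simpa using hm)
  · simp only [Set.mem_ofPred_eq, Complex.re_ofNat]; linarith
  · have ho' : IsOpen {s : ℂ | 1 < s.re} := isOpen_lt continuous_const Complex.continuous_re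
    filter_upwards [ho'.mem_nhds (show (2 : ℂ) ∈ {s : ℂ | 1 < s.re} by simp)] with s hs
    exact (s₁ s hs).unique (s₂ s hs)

/-- The coordinate of `x ∧ y ∈ ⋀²_ℝ ℂ` with respect to the basis `1 ∧ i`. -/
def wedge (x y : ℂ) : ℝ := x.re * y.im - x.im * y.re

/-- The coordinate with respect to `1 ∧ i` of the generator `α_L` of `⋀²_ℤ L` that is a positive
multiple of `1 ∧ i`. Every element of `⋀²_ℤ L` is of the form `x ∧ y` with `x, y ∈ L` because
`L` has rank two, so this is the least positive value of `x ∧ y`. -/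
def latticeOrientation (L : Submodule ℤ ℂ) : ℝ :=
  sInf {r : ℝ | 0 < r ∧ ∃ x ∈ L, ∃ y ∈ L, wedge x y = r}

/-- The character `χ^L_u(v) = exp(2πi N (u ∧ v) / α_L)`, for `u, v ∈ N⁻¹L`. -/
def latticeChar (N : ℕ) (L : Submodule ℤ ℂ) (u v : ℂ) : ℂ :=
  Complex.exp (2 * (Real.pi : ℂ) * Complex.I *
    (((N : ℝ) * (wedge u v / latticeOrientation L) : ℝ) : ℂ))

/-- `G'(L, u) = ∑ χ^L_u(w) G(L, w)`, over `w ∈ N⁻¹L / L`, that is, over the `N`-torsion classes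
`c` of `ℂ / L` (each term depends only on the class of `w` when `u ∈ N⁻¹L`). -/
def heckeG' (N : ℕ) (L : Submodule ℤ ℂ) (u : ℂ) : ℂ :=
  ∑ᶠ c : {c : ℂ ⧸ L // (N : ℤ) • c = 0},
    latticeChar N L u (Quotient.out c.1) * heckeG N L (Quotient.out c.1)

/-- The integers `m`, positive or negative, with `m ∣ n` and `m ≡ ℓ mod N` (for `n ≥ 1`). -/
def divisorsCongr (N : ℕ) (ℓ : ℤ) (n : ℕ) : Finset ℤ :=
  (Finset.Icc (-(n : ℤ)) n).filter fun m => m ∣ (n : ℤ) ∧ m ≡ ℓ [ZMOD N]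

end HeckeEisenstein

end

noncomputable section

namespace HeckeEisenstein

/-! Write `L = lam (ℤ + ℤτ)` and `ω = lam (dτ + c)`. Every `ω` in `L` contributes to exactly one
torsion class, that of `ω / N`, so `G'(L, u)` is the value at `s = 0` of the continuation of `∑
χ_u(ω/N) ω⁻¹ |ω|⁻ˢ` over `L` (`heckeG'_eq`). For `u = lam (bτ + a)` the character is `e(ad - bc)`
with `e(x) = exp(2πix)`.

If a character takes a value `ζ ≠ 1` on some translation, Abel summation twice in that direction
replaces the term by its second difference, of size `|ω|^(-3 - Re s)`. This converges absolutely
beyond `s = 0` and gives the continuation (`isTwistedContinuation_of_translate`). The untwisted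
series vanishes by oddness, and characters mod `N` span the indicators of cosets, so every `Φ(L, w,
s)` continues too.

For `b = ℓ/N`, which is not an integer, the direction of `c` serves. At `s = 0` the absolutely
convergent double series may be summed over `c` first. The Fourier series of `e(xz)` on `[0, 1)`
gives `∑ e(-xc)/(z + c) = 2πi e(xz)/(e(z) - 1)`, and that of `x - 1/2` gives the row `d = 0`, hence
the constant term (`hasSum_lerchValue`). Geometric expansion of the rows `d > 0` and `d < 0`
produces the positive and negative `m ≡ ℓ`, and collecting `n = |d m|` yields the `q`-expansion
(`hasSum_qExpansion`).

Keeping `lam` arbitrary settles the cusp `0` as well: the lattice of `-1/τ` is the case `lam =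
2πi/τ`, where `2πiℓ/N = lam ℓτ/N`. -/

/-! ### The summand along a line, and the size of its second difference -/

/-- The summand `z⁻¹ |z|⁻ˢ` of Hecke's series; it vanishes at `z = 0`. -/
def heckeTerm (s z : ℂ) : ℂ := z⁻¹ * ((‖z‖ : ℝ) : ℂ) ^ (-s)

@[simp] theorem heckeTerm_zero_right (s : ℂ) : heckeTerm s 0 = 0 := by simp [heckeTerm]

@[simp] theorem heckeTerm_zero_left (z : ℂ) : heckeTerm 0 z = z⁻¹ := by simp [heckeTerm]

theorem heckeTerm_neg (s z : ℂ) : heckeTerm s (-z) = -heckeTerm s z := by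
  simp [heckeTerm, inv_neg]

theorem heckeTerm_eq_exp (s : ℂ) {z : ℂ} (hz : z ≠ 0) :
    heckeTerm s z = z⁻¹ * Complex.exp (-s * (Real.log ‖z‖ : ℝ)) := by
  have : ((‖z‖ : ℝ) : ℂ) ≠ 0 := by simpa using hz
  rw [heckeTerm, Complex.cpow_def_of_ne_zero this, Complex.ofReal_log (norm_nonneg z), mul_comm (-s)]

theorem norm_heckeTerm (s : ℂ) {z : ℂ} (hz : z ≠ 0) :
    ‖heckeTerm s z‖ = ‖z‖ ^ (-(1 + s.re)) := by
  have h : 0 < ‖z‖ := norm_pos_iff.2 hz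
  rw [heckeTerm, norm_mul, norm_inv, Complex.norm_cpow_eq_rpow_re_of_pos h, neg_add,
    Real.rpow_add h, Real.rpow_neg_one, Complex.neg_re]

theorem differentiable_heckeTerm (z : ℂ) : Differentiable ℂ fun s => heckeTerm s z := by
  rcases eq_or_ne z 0 with rfl | hz
  · simp
  · simp only [heckeTerm_eq_exp _ hz]
    fun_prop

theorem hasDerivAt_line (z h : ℂ) (t : ℝ) : HasDerivAt (fun t : ℝ => z + t * h) h t := by
  simpa using ((Complex.ofRealCLM.hasDerivAt (x := t)).mul_const h).const_add z

theorem hasDerivAt_log_norm (z h : ℂ) (t : ℝ) (hw : z + t * h ≠ 0) :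
    HasDerivAt (fun t : ℝ => Real.log ‖z + t * h‖) (h / (z + t * h)).re t := by
  have h1 := hasDerivAt_line z h t
  -- The norm is differentiated through `log ‖w‖ = (log ‖w‖²) / 2`.
  have h2 := (h1.norm_sq.log (by simpa using hw)).div_const 2
  have hw' : ‖z + t * h‖ ≠ 0 := by simpa using hw
  refine (h2.congr_deriv ?_).congr_of_eventuallyEq (.of_forall fun t => ?_)
  · rw [Complex.div_re, Complex.normSq_eq_norm_sq, Complex.inner]
    simp only [Complex.mul_re, Complex.conj_re, Complex.conj_im]
    field_simp
    ring
  · simp only [Real.log_pow]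
    push_cast
    ring

/-- The logarithmic derivative of `t ↦ heckeTerm s (z + t h)`, as a function of
`η = h / (z + t h)`, is the negative of this. -/
def logDerivTerm (s η : ℂ) : ℂ := η + s * (η.re : ℂ)

theorem norm_logDerivTerm_le (s η : ℂ) : ‖logDerivTerm s η‖ ≤ (1 + ‖s‖) * ‖η‖ := by
  have : ‖(η.re : ℂ)‖ ≤ ‖η‖ := by simpa using Complex.abs_re_le_norm η
  calc ‖logDerivTerm s η‖ ≤ ‖η‖ + ‖s‖ * ‖(η.re : ℂ)‖ := by
        rw [logDerivTerm, ← norm_mul]; exact norm_add_le _ _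
    _ ≤ ‖η‖ + ‖s‖ * ‖η‖ := by gcongr
    _ = _ := by ring

theorem hasDerivAt_heckeTerm (s z h : ℂ) (t : ℝ) (hw : z + t * h ≠ 0) :
    HasDerivAt (fun t : ℝ => heckeTerm s (z + t * h))
      (-(heckeTerm s (z + t * h) * logDerivTerm s (h / (z + t * h)))) t := by
  have h1 := hasDerivAt_line z h t
  have h2 := (((hasDerivAt_log_norm z h t hw).ofReal_comp).const_mul (-s)).cexp
  have h3 := (h1.fun_inv hw).mul h2
  have hev : ∀ᶠ t' : ℝ in nhds t, z + t' * h ≠ 0 := h1.continuousAt.eventually_ne hw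
  refine (h3.congr_deriv ?_).congr_of_eventuallyEq (hev.mono fun t' ht => ?_)
  · rw [heckeTerm_eq_exp _ hw, logDerivTerm]
    generalize Complex.exp _ = e
    generalize (h / (z + t * h)).re = r
    generalize z + t * h = w at hw ⊢
    field_simp
    ring
  · simpa using heckeTerm_eq_exp s ht

theorem hasDerivAt_logDerivTerm (s z h : ℂ) (t : ℝ) (hw : z + t * h ≠ 0) :
    HasDerivAt (fun t : ℝ => logDerivTerm s (h / (z + t * h)))
      (-logDerivTerm s ((h / (z + t * h)) ^ 2)) t := by
  have h1 : HasDerivAt (fun t : ℝ => h / (z + t * h)) (-(h / (z + t * h)) ^ 2) t := by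
    refine (((hasDerivAt_line z h t).fun_inv hw).const_mul h).congr_deriv ?_ |>.congr_of_eventuallyEq
      (.of_forall fun t' => ?_)
    · field_simp
    · simp [div_eq_mul_inv]
  have h2 : HasDerivAt (fun t : ℝ => (h / (z + t * h)).re) (-(h / (z + t * h)) ^ 2).re t :=
    (Complex.reCLM.hasFDerivAt.comp_hasDerivAt t h1)
  refine (h1.add (h2.ofReal_comp.const_mul s)).congr_deriv ?_
  simp only [logDerivTerm, Complex.neg_re, Complex.ofReal_neg]
  ring

/-- The second derivative of `t ↦ heckeTerm s (z + t h)`. -/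
def heckeTermDeriv₂ (s z h : ℂ) (t : ℝ) : ℂ :=
  heckeTerm s (z + t * h) *
    (logDerivTerm s (h / (z + t * h)) ^ 2 + logDerivTerm s ((h / (z + t * h)) ^ 2))

theorem hasDerivAt_heckeTermDeriv (s z h : ℂ) (t : ℝ) (hw : z + t * h ≠ 0) :
    HasDerivAt (fun t : ℝ => -(heckeTerm s (z + t * h) * logDerivTerm s (h / (z + t * h))))
      (heckeTermDeriv₂ s z h t) t := by
  refine ((hasDerivAt_heckeTerm s z h t hw).mul
    (hasDerivAt_logDerivTerm s z h t hw)).fun_neg.congr_deriv ?_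
  simp only [heckeTermDeriv₂]
  ring

theorem norm_heckeTermDeriv₂_le (s z h : ℂ) (t : ℝ) (hw : z + t * h ≠ 0) :
    ‖heckeTermDeriv₂ s z h t‖ ≤
      2 * (1 + ‖s‖) ^ 2 * ‖h‖ ^ 2 * ‖z + t * h‖ ^ (-(3 + s.re)) := by
  set w := z + t * h with hwdef
  have hp : 0 < ‖w‖ := norm_pos_iff.2 hw
  have h1 := norm_logDerivTerm_le s (h / w)
  have h2 := norm_logDerivTerm_le s ((h / w) ^ 2)
  have h3 : ‖logDerivTerm s (h / w) ^ 2 + logDerivTerm s ((h / w) ^ 2)‖ ≤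
      2 * (1 + ‖s‖) ^ 2 * ‖h / w‖ ^ 2 := by
    calc _ ≤ ‖logDerivTerm s (h / w)‖ ^ 2 + ‖logDerivTerm s ((h / w) ^ 2)‖ := by
          rw [← norm_pow]; exact norm_add_le _ _
      _ ≤ ((1 + ‖s‖) * ‖h / w‖) ^ 2 + (1 + ‖s‖) * ‖(h / w) ^ 2‖ := by gcongr
      _ = ((1 + ‖s‖) ^ 2 + (1 + ‖s‖)) * ‖h / w‖ ^ 2 := by rw [norm_pow]; ring
      _ ≤ _ := by
          gcongr
          nlinarith [norm_nonneg s]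
  have h4 : ‖w‖ ^ (-(3 + s.re)) = ‖w‖ ^ (-(1 + s.re)) * (‖w‖ ^ 2)⁻¹ := by
    rw [show -(3 + s.re) = -(1 + s.re) + -(2 : ℕ) by push_cast; ring, Real.rpow_add hp,
      Real.rpow_neg hp.le (2 : ℕ), Real.rpow_natCast]
  rw [heckeTermDeriv₂, norm_mul, ← hwdef, norm_heckeTerm s hw, h4]
  calc _ ≤ ‖w‖ ^ (-(1 + s.re)) * (2 * (1 + ‖s‖) ^ 2 * ‖h / w‖ ^ 2) := by gcongr
    _ = _ := by rw [norm_div]; field_simp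

/-- The second difference of `heckeTerm s` at `z` with step `h`. -/
def heckeDiff₂ (s z h : ℂ) : ℂ :=
  heckeTerm s (z + 2 * h) - 2 * heckeTerm s (z + h) + heckeTerm s z

theorem norm_sub_le_of_hasDerivAt {f f' : ℝ → ℂ} {C : ℝ} {a b : ℝ} (hab : a ≤ b)
    (hf : ∀ t ∈ Set.Icc a b, HasDerivAt f (f' t) t) (hC : ∀ t ∈ Set.Icc a b, ‖f' t‖ ≤ C) :
    ‖f b - f a‖ ≤ C * (b - a) := by
  have := Convex.norm_image_sub_le_of_norm_hasDerivWithin_le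
    (fun t ht => (hf t ht).hasDerivWithinAt) hC (convex_Icc a b)
    (Set.left_mem_Icc.2 hab) (Set.right_mem_Icc.2 hab)
  rwa [Real.norm_of_nonneg (sub_nonneg.2 hab)] at this

/-- The mean value inequality is used twice: for `g'` on `[t, t + 1]`, then for `t ↦ g (t + 1) - g
t` on `[0, 1]`. -/
theorem norm_second_difference_le {g g' g'' : ℝ → ℂ} {C : ℝ}
    (h1 : ∀ t ∈ Set.Icc (0 : ℝ) 2, HasDerivAt g (g' t) t)
    (h2 : ∀ t ∈ Set.Icc (0 : ℝ) 2, HasDerivAt g' (g'' t) t)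
    (hC : ∀ t ∈ Set.Icc (0 : ℝ) 2, ‖g'' t‖ ≤ C) :
    ‖g 2 - 2 * g 1 + g 0‖ ≤ C := by
  have key : ∀ t ∈ Set.Icc (0 : ℝ) 1, ‖g' (t + 1) - g' t‖ ≤ C := fun t ht => by
    have := norm_sub_le_of_hasDerivAt (f := g') (a := t) (b := t + 1) (by linarith)
      (fun u hu => h2 u ⟨ht.1.trans hu.1, by linarith [hu.2, ht.2]⟩)
      (fun u hu => hC u ⟨ht.1.trans hu.1, by linarith [hu.2, ht.2]⟩)
    simpa using this
  have := norm_sub_le_of_hasDerivAt (f := fun t => g (t + 1) - g t) zero_le_one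
    (fun t ht => ((h1 (t + 1) ⟨by linarith [ht.1], by linarith [ht.2]⟩).comp_add_const t 1).sub
      (h1 t ⟨ht.1, by linarith [ht.2]⟩)) key
  norm_num at this
  convert this using 2
  ring

/-- The condition `4‖h‖ ≤ ‖z‖` keeps the segment from `z` to `z + 2h` at distance at least `‖z‖/2`
from the origin; `2 ≤ ‖z‖` makes that base at least `1`, so that `3 + Re s > 5/2` can be replaced by
`5/2`. This exponent exceeds `2`, hence is summable over a lattice, and does not depend on `s`. -/
theorem norm_heckeDiff₂_le {s z h : ℂ} {R : ℝ} (hs : -(1 / 2) < s.re) (hR : ‖s‖ ≤ R)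
    (hz : 2 ≤ ‖z‖) (hzh : 4 * ‖h‖ ≤ ‖z‖) :
    ‖heckeDiff₂ s z h‖ ≤ 2 * (1 + R) ^ 2 * ‖h‖ ^ 2 * (‖z‖ / 2) ^ (-(5 / 2 : ℝ)) := by
  have hw : ∀ t ∈ Set.Icc (0 : ℝ) 2, ‖z‖ / 2 ≤ ‖z + t * h‖ := fun t ht => by
    have h1 : ‖(t : ℂ) * h‖ ≤ 2 * ‖h‖ := by
      rw [norm_mul, Complex.norm_real, Real.norm_of_nonneg ht.1]
      gcongr
      exact ht.2
    have h2 := norm_sub_le_norm_add z ((t : ℂ) * h)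
    linarith
  have hw0 : ∀ t ∈ Set.Icc (0 : ℝ) 2, z + t * h ≠ 0 := fun t ht =>
    norm_pos_iff.1 (by linarith [hw t ht])
  have := norm_second_difference_le (g := fun t : ℝ => heckeTerm s (z + t * h))
    (C := 2 * (1 + R) ^ 2 * ‖h‖ ^ 2 * (‖z‖ / 2) ^ (-(5 / 2 : ℝ)))
    (fun t ht => hasDerivAt_heckeTerm s z h t (hw0 t ht))
    (fun t ht => hasDerivAt_heckeTermDeriv s z h t (hw0 t ht)) (fun t ht => by
      refine (norm_heckeTermDeriv₂_le s z h t (hw0 t ht)).trans ?_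
      have h1 : ‖z + t * h‖ ^ (-(3 + s.re)) ≤ (‖z‖ / 2) ^ (-(5 / 2 : ℝ)) := by
        have hz1 : 1 ≤ ‖z‖ / 2 := by linarith
        calc _ ≤ (‖z‖ / 2) ^ (-(3 + s.re)) :=
              Real.rpow_le_rpow_of_nonpos (by linarith) (hw t ht) (by linarith)
          _ ≤ _ := Real.rpow_le_rpow_of_exponent_le hz1 (by linarith)
      gcongr)
  simpa [heckeDiff₂] using this

/-! ### Lattice sums and their locally uniform convergence -/

/-- The point `lam (d τ + c)` of the lattice spanned by `lam` and `lam τ`, for `v = (d, c)`. -/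
def latticePoint (lam τ : ℂ) (v : ℤ × ℤ) : ℂ := lam * (v.1 * τ + v.2)

theorem hasSum_of_eq {ι : Type*} {f g : ι → ℂ} {a b : ℂ} (h : HasSum f a) (hf : ∀ i, g i = f i)
    (hb : b = a) : HasSum g b := by
  rwa [funext hf, hb]

theorem latticePoint_add (lam τ : ℂ) (v w : ℤ × ℤ) :
    latticePoint lam τ (v + w) = latticePoint lam τ v + latticePoint lam τ w := by
  simp only [latticePoint, Prod.fst_add, Prod.snd_add]
  push_cast
  ring

theorem latticePoint_neg (lam τ : ℂ) (v : ℤ × ℤ) :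
    latticePoint lam τ (-v) = -latticePoint lam τ v := by
  simp only [latticePoint, Prod.fst_neg, Prod.snd_neg]
  push_cast
  ring

theorem latticePoint_eq_zero {lam : ℂ} (hlam : lam ≠ 0) (τ : ℍ) {v : ℤ × ℤ}
    (h : latticePoint lam τ v = 0) : v = 0 := by
  have h1 : (v.1 : ℂ) * τ + v.2 = 0 := (mul_eq_zero.1 h).resolve_left hlam
  have him := congrArg Complex.im h1
  have hre := congrArg Complex.re h1
  have hd : v.1 = 0 := by simpa [τ.im_ne_zero] using him
  have hc : v.2 = 0 := by simpa [hd] using hre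
  exact Prod.ext hd hc

theorem latticePoint_injective {lam : ℂ} (hlam : lam ≠ 0) (τ : ℍ) :
    Function.Injective (latticePoint lam τ) := fun v w h => by
  refine sub_eq_zero.1 (latticePoint_eq_zero hlam τ ?_)
  rw [sub_eq_add_neg, latticePoint_add, latticePoint_neg, h, add_neg_cancel]

theorem summable_norm_latticePoint_rpow {lam : ℂ} (hlam : lam ≠ 0) (τ : ℍ) {k : ℝ} (hk : 2 < k) :
    Summable fun v => ‖latticePoint lam τ v‖ ^ (-k) := by
  rw [← (finTwoArrowEquiv ℤ).summable_iff]
  refine Summable.of_nonneg_of_le (fun x => Real.rpow_nonneg (norm_nonneg _) _) (fun x => ?_)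
    ((EisensteinSeries.summable_one_div_norm_rpow hk).mul_left
      (‖lam‖ ^ (-k) * EisensteinSeries.r τ ^ (-k)))
  have := EisensteinSeries.summand_bound τ (by linarith : 0 ≤ k) x
  have hx : ‖latticePoint lam τ (finTwoArrowEquiv ℤ x)‖ = ‖lam‖ * ‖(x 0 : ℂ) * τ + x 1‖ :=
    norm_mul _ _
  rw [Function.comp, hx, Real.mul_rpow (norm_nonneg _) (norm_nonneg _), mul_assoc]
  exact mul_le_mul_of_nonneg_left this (by positivity)

theorem finite_norm_latticePoint_lt {lam : ℂ} (hlam : lam ≠ 0) (τ : ℍ) (R : ℝ) :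
    {v | ‖latticePoint lam τ v‖ < R}.Finite := by
  wlog hR : 0 < R
  · exact (this hlam τ 1 one_pos).subset fun v hv =>
      lt_of_lt_of_le (Set.mem_ofPred.1 hv) ((not_lt.1 hR).trans zero_le_one)
  have h := (summable_norm_latticePoint_rpow hlam τ (k := 3) (by norm_num)).tendsto_cofinite_zero
  have h1 := h.eventually (gt_mem_nhds (Real.rpow_pos_of_pos hR (-3)))
  -- The origin is treated apart because `0 ^ (-3) = 0` for real powers.
  refine ((Set.finite_singleton 0).union (Filter.eventually_cofinite.1 h1)).subset fun v hv => ?_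
  rcases eq_or_ne v 0 with rfl | hv0
  · exact Or.inl rfl
  · refine Or.inr (not_lt.2 ?_)
    have hp : 0 < ‖latticePoint lam τ v‖ :=
      norm_pos_iff.2 fun h => hv0 (latticePoint_eq_zero hlam τ h)
    exact Real.rpow_le_rpow_of_nonpos hp (le_of_lt hv) (by norm_num)

theorem summable_heckeTerm {lam : ℂ} (hlam : lam ≠ 0) (τ : ℍ) {s : ℂ} (hs : 1 < s.re)
    {φ : ℤ × ℤ → ℂ} {B : ℝ} (hφ : ∀ v, ‖φ v‖ ≤ B) :
    Summable fun v => φ v * heckeTerm s (latticePoint lam τ v) := by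
  refine Summable.of_norm_bounded ((summable_norm_latticePoint_rpow hlam τ
    (k := 1 + s.re) (by linarith)).mul_left B) fun v => ?_
  rw [norm_mul]
  refine mul_le_mul (hφ v) ?_ (norm_nonneg _) ((norm_nonneg _).trans (hφ v))
  rcases eq_or_ne (latticePoint lam τ v) 0 with h | h
  · rw [h, heckeTerm_zero_right, norm_zero]; positivity
  · rw [norm_heckeTerm s h]

theorem differentiable_heckeDiff₂ (z h : ℂ) : Differentiable ℂ fun s => heckeDiff₂ s z h :=
  ((differentiable_heckeTerm _).sub ((differentiable_heckeTerm _).const_mul 2)).add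
    (differentiable_heckeTerm _)

/-- The decay estimate needs `z` large compared with `h`. Only finitely many lattice points fail
this, and for them continuity in `s` on the compact ball supplies a constant. -/
theorem exists_summable_bound_heckeDiff₂ {lam : ℂ} (hlam : lam ≠ 0) (τ : ℍ) (h : ℂ) (R : ℝ) :
    ∃ u : ℤ × ℤ → ℝ, Summable u ∧ ∀ v, ∀ s : ℂ, -(1 / 2) < s.re → ‖s‖ ≤ R →
      ‖heckeDiff₂ s (latticePoint lam τ v) h‖ ≤ u v := by
  have hb : ∀ v, ∃ C, ∀ s ∈ Metric.closedBall (0 : ℂ) R,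
      ‖heckeDiff₂ s (latticePoint lam τ v) h‖ ≤ C := fun v =>
    (isCompact_closedBall (0 : ℂ) R).exists_bound_of_continuousOn
      (differentiable_heckeDiff₂ _ _).continuous.continuousOn
  choose C hC using hb
  set M : ℝ := max 2 (4 * ‖h‖)
  set u₀ : ℤ × ℤ → ℝ := fun v =>
    2 * (1 + R) ^ 2 * ‖h‖ ^ 2 * (‖latticePoint lam τ v‖ / 2) ^ (-(5 / 2 : ℝ))
  have hu₀ : Summable u₀ := by
    refine Summable.mul_left _ ?_
    simp only [Real.div_rpow (norm_nonneg _) zero_le_two]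
    exact (summable_norm_latticePoint_rpow hlam τ (by norm_num)).div_const _
  refine ⟨fun v => if ‖latticePoint lam τ v‖ < M then C v else u₀ v, hu₀.congr_cofinite ?_, ?_⟩
  · filter_upwards [(finite_norm_latticePoint_lt hlam τ M).compl_mem_cofinite] with v hv
    exact (if_neg hv).symm
  · intro v s hs hR
    dsimp only
    split_ifs with hv
    · exact hC v s (by simpa using hR)
    · have hv' := not_lt.1 hv
      exact norm_heckeDiff₂_le hs hR ((le_max_left _ _).trans hv') ((le_max_right _ _).trans hv')

theorem summable_heckeDiff₂ {lam : ℂ} (hlam : lam ≠ 0) (τ : ℍ) (h : ℂ) {s : ℂ}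
    (hs : -(1 / 2) < s.re) {ψ : ℤ × ℤ → ℂ} (hψ : ∀ v, ‖ψ v‖ ≤ 1) :
    Summable fun v => ψ v * heckeDiff₂ s (latticePoint lam τ v) h := by
  obtain ⟨u, hu, hb⟩ := exists_summable_bound_heckeDiff₂ hlam τ h ‖s‖
  refine Summable.of_norm_bounded hu fun v => ?_
  rw [norm_mul]
  calc _ ≤ 1 * u v := mul_le_mul (hψ v) (hb v s hs le_rfl) (norm_nonneg _) zero_le_one
    _ = _ := one_mul _

theorem differentiableOn_tsum_heckeDiff₂ {lam : ℂ} (hlam : lam ≠ 0) (τ : ℍ) (h : ℂ)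
    {ψ : ℤ × ℤ → ℂ} (hψ : ∀ v, ‖ψ v‖ ≤ 1) :
    DifferentiableOn ℂ (fun s => ∑' v, ψ v * heckeDiff₂ s (latticePoint lam τ v) h)
      {s | -(1 / 2) < s.re} := by
  intro s₀ hs₀
  obtain ⟨u, hu, hb⟩ := exists_summable_bound_heckeDiff₂ hlam τ h (‖s₀‖ + 1)
  have ho : IsOpen ({s : ℂ | -(1 / 2) < s.re} ∩ Metric.ball 0 (‖s₀‖ + 1)) :=
    (isOpen_lt continuous_const Complex.continuous_re).inter Metric.isOpen_ball
  have hd := Complex.differentiableOn_tsum_of_summable_norm (F := fun v s =>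
    ψ v * heckeDiff₂ s (latticePoint lam τ v) h) hu
    (fun v => ((differentiable_heckeDiff₂ _ _).const_mul _).differentiableOn) ho
    fun v s hs => by
      rw [norm_mul]
      calc _ ≤ 1 * u v := mul_le_mul (hψ v)
            (hb v s hs.1 (by simpa using (mem_ball_zero_iff.1 hs.2).le)) (norm_nonneg _) zero_le_one
        _ = _ := one_mul _
  exact (hd.differentiableAt (ho.mem_nhds ⟨hs₀, by simp⟩)).differentiableWithinAt

/-! ### Analytic continuation of twisted and of coset series -/

/-- `F` continues `∑' φ v ω⁻¹ |ω|⁻ˢ`, with `ω = lam (d τ + c)` for `v = (d, c)`, to the half-plane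
`Re s > -1/2`. -/
structure IsTwistedContinuation (lam τ : ℂ) (φ : ℤ × ℤ → ℂ) (F : ℂ → ℂ) : Prop where
  differentiableOn : DifferentiableOn ℂ F {s | -(1 / 2) < s.re}
  hasSum : ∀ s : ℂ, 1 < s.re → HasSum (fun v => φ v * heckeTerm s (latticePoint lam τ v)) (F s)

namespace IsTwistedContinuation

variable {lam τ : ℂ} {φ : ℤ × ℤ → ℂ} {F : ℂ → ℂ}

theorem congr {φ' : ℤ × ℤ → ℂ} (h : IsTwistedContinuation lam τ φ F) (hφ : ∀ v, φ' v = φ v) :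
    IsTwistedContinuation lam τ φ' F := by
  rwa [funext hφ]

theorem const_mul (h : IsTwistedContinuation lam τ φ F) (a : ℂ) :
    IsTwistedContinuation lam τ (fun v => a * φ v) fun s => a * F s where
  differentiableOn := h.differentiableOn.const_mul a
  hasSum s hs := by simpa only [mul_assoc] using (h.hasSum s hs).mul_left a

theorem sum {ι : Type*} {t : Finset ι} {φ : ι → ℤ × ℤ → ℂ} {F : ι → ℂ → ℂ}
    (h : ∀ i ∈ t, IsTwistedContinuation lam τ (φ i) (F i)) :
    IsTwistedContinuation lam τ (fun v => ∑ i ∈ t, φ i v) fun s => ∑ i ∈ t, F i s where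
  differentiableOn := DifferentiableOn.fun_sum fun i hi => (h i hi).differentiableOn
  hasSum s hs := by
    simpa only [Finset.sum_mul] using hasSum_sum fun i hi => (h i hi).hasSum s hs

theorem eq_at_zero {G : ℂ → ℂ} (hF : IsTwistedContinuation lam τ φ F)
    (hG : IsTwistedContinuation lam τ φ G) : F 0 = G 0 := by
  have ho : IsOpen {s : ℂ | -(1 / 2) < s.re} := isOpen_lt continuous_const Complex.continuous_re
  have hc : IsPreconnected {s : ℂ | -(1 / 2) < s.re} :=
    (convex_halfSpace_re_gt (-(1 / 2))).isPreconnected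
  refine (hF.differentiableOn.analyticOnNhd ho).eqOn_of_preconnected_of_eventuallyEq
    (hG.differentiableOn.analyticOnNhd ho) hc (z₀ := 2) ?_ ?_ (by simp)
  · simp only [Set.mem_ofPred_eq, Complex.re_ofNat]; norm_num
  · have ho' : IsOpen {s : ℂ | 1 < s.re} := isOpen_lt continuous_const Complex.continuous_re
    filter_upwards [ho'.mem_nhds (show (2 : ℂ) ∈ {s : ℂ | 1 < s.re} by simp)] with s hs
    exact (hF.hasSum s hs).unique (hG.hasSum s hs)

end IsTwistedContinuation

/-- Abel summation (twice) continues a series twisted by a nontrivial character. -/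
theorem isTwistedContinuation_of_translate {lam : ℂ} (hlam : lam ≠ 0) (τ : ℍ) {ψ : ℤ × ℤ → ℂ}
    (hψ : ∀ v, ‖ψ v‖ ≤ 1) {v₀ : ℤ × ℤ} {ζ : ℂ} (hζ : ζ ≠ 1) (hζ0 : ζ ≠ 0)
    (htr : ∀ v, ψ (v + v₀) = ζ * ψ v) :
    IsTwistedContinuation lam τ ψ fun s => ((ζ⁻¹ - 1) ^ 2)⁻¹ *
      ∑' v, ψ v * heckeDiff₂ s (latticePoint lam τ v) (latticePoint lam τ v₀) where
  differentiableOn := (differentiableOn_tsum_heckeDiff₂ hlam τ _ hψ).const_mul _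
  hasSum s hs := by
    have hne : (ζ⁻¹ - 1) ^ 2 ≠ 0 := pow_ne_zero 2 (sub_ne_zero.2 (by simpa using hζ))
    have h0 := summable_heckeTerm hlam τ hs hψ
    -- Reindexing by `v ↦ v + v₀` shows that shifting the argument by `n v₀` multiplies the sum by
    -- `ζ⁻ⁿ`; the second difference therefore multiplies it by `(ζ⁻¹ - 1)²`.
    have hshift : ∀ n : ℕ, HasSum (fun v => ψ v * heckeTerm s (latticePoint lam τ v +
        n * latticePoint lam τ v₀))
        (ζ⁻¹ ^ n * ∑' v, ψ v * heckeTerm s (latticePoint lam τ v)) := fun n => by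
      induction n with
      | zero => simpa using h0.hasSum
      | succ n ih =>
        rw [← (Equiv.addRight v₀).hasSum_iff] at ih
        refine hasSum_of_eq (ih.mul_left ζ⁻¹) (fun v => ?_) ?_
        · simp only [Function.comp, Equiv.coe_addRight, htr, latticePoint_add]
          rw [mul_assoc ζ, inv_mul_cancel_left₀ hζ0]
          push_cast
          ring_nf
        · rw [pow_succ']
          ring
    have hsum : HasSum (fun v => ψ v * heckeDiff₂ s (latticePoint lam τ v) (latticePoint lam τ v₀))
        ((ζ⁻¹ - 1) ^ 2 * ∑' v, ψ v * heckeTerm s (latticePoint lam τ v)) := by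
      refine hasSum_of_eq (((hshift 2).sub ((hshift 1).mul_left 2)).add (hshift 0))
        (fun v => ?_) ?_
      · simp only [heckeDiff₂, Nat.cast_ofNat, Nat.cast_one, Nat.cast_zero, one_mul, zero_mul,
          add_zero]
        ring
      · ring
    rw [hsum.tsum_eq, inv_mul_cancel_left₀ hne]
    exact h0.hasSum

/-- The summand is odd, so `v ↦ -v` shows that the sum equals its own negative. -/
theorem isTwistedContinuation_one {lam : ℂ} (hlam : lam ≠ 0) (τ : ℍ) :
    IsTwistedContinuation lam τ (fun _ => 1) 0 where
  differentiableOn := differentiableOn_const 0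
  hasSum s hs := by
    have h0 := (summable_heckeTerm hlam τ hs (φ := fun _ => 1) (B := 1) (by simp)).hasSum
    have h1 := (Equiv.neg (ℤ × ℤ)).hasSum_iff.2 h0
    have h2 : HasSum (fun v => (1 : ℂ) * heckeTerm s (latticePoint lam τ v))
        (-∑' v, (1 : ℂ) * heckeTerm s (latticePoint lam τ v)) := by
      refine hasSum_of_eq h1.neg (fun v => ?_) rfl
      simp [latticePoint_neg, heckeTerm_neg]
    have h3 := self_eq_neg.1 (h0.unique h2)
    rwa [h3] at h0

/-- A nontrivial character mod `N` differs from `1` on `(0, 1)` or on `(1, 0)`, so Abel summation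
applies in that direction; the trivial one is covered by oddness. -/
theorem exists_isTwistedContinuation_char {lam : ℂ} (hlam : lam ≠ 0) (τ : ℍ) (N : ℕ) [NeZero N]
    (j k : ZMod N) : ∃ F, IsTwistedContinuation lam τ
      (fun v => (ZMod.stdAddChar (j * (v.1 : ZMod N) + k * (v.2 : ZMod N)) : ℂ)) F := by
  have hn : ∀ v : ℤ × ℤ,
      ‖(ZMod.stdAddChar (j * (v.1 : ZMod N) + k * (v.2 : ZMod N)) : ℂ)‖ ≤ 1 := fun v => by
    simp [AddChar.norm_apply]
  have h1 : ∀ x : ZMod N, x ≠ 0 → (ZMod.stdAddChar x : ℂ) ≠ 1 := fun x hx h =>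
    hx (ZMod.injective_stdAddChar (by simpa using h))
  have h0 : ∀ x : ZMod N, (ZMod.stdAddChar x : ℂ) ≠ 0 := fun x h => by
    simpa [h] using AddChar.norm_apply (ZMod.stdAddChar (N := N)) x
  by_cases hj : j = 0
  · by_cases hk : k = 0
    · subst hj hk
      exact ⟨0, by simpa using isTwistedContinuation_one hlam τ⟩
    · refine ⟨_, isTwistedContinuation_of_translate hlam τ hn (v₀ := (0, 1)) (h1 k hk) (h0 k)
        fun v => ?_⟩
      rw [← AddChar.map_add_eq_mul]
      simp only [Prod.fst_add, Prod.snd_add]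
      push_cast
      congr 1
      ring
  · refine ⟨_, isTwistedContinuation_of_translate hlam τ hn (v₀ := (1, 0)) (h1 j hj) (h0 j)
        fun v => ?_⟩
    rw [← AddChar.map_add_eq_mul]
    simp only [Prod.fst_add, Prod.snd_add]
    push_cast
    congr 1
    ring

/-- By orthogonality of characters the indicator of a class mod `N` is a linear combination of
characters of `(ℤ/N)²`. -/
theorem exists_isTwistedContinuation_coset {lam : ℂ} (hlam : lam ≠ 0) (τ : ℍ) (N : ℕ) [NeZero N]
    (a b : ℤ) : ∃ F, IsTwistedContinuation lam τ
      (fun v => if (v.1 : ZMod N) = a ∧ (v.2 : ZMod N) = b then 1 else 0) F := by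
  choose F hF using exists_isTwistedContinuation_char hlam τ N
  have key := (IsTwistedContinuation.sum (t := Finset.univ) fun (p : ZMod N × ZMod N) _ =>
      (hF p.1 p.2).const_mul ((ZMod.stdAddChar (-(p.1 * (a : ZMod N) + p.2 * (b : ZMod N))) : ℂ))).const_mul
        ((N : ℂ) ^ 2)⁻¹
  refine ⟨_, key.congr fun v => ?_⟩
  · have hN : (N : ℂ) ≠ 0 := NeZero.ne _
    have hs := fun x : ZMod N => AddChar.sum_mulShift (ψ := ZMod.stdAddChar (N := N)) x
      (ZMod.isPrimitive_stdAddChar N)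
    have : ∑ p : ZMod N × ZMod N, (ZMod.stdAddChar (-(p.1 * (a : ZMod N) + p.2 * (b : ZMod N))) : ℂ) *
        ZMod.stdAddChar (p.1 * (v.1 : ZMod N) + p.2 * (v.2 : ZMod N)) =
        (∑ x : ZMod N, (ZMod.stdAddChar (x * ((v.1 : ZMod N) - (a : ZMod N))) : ℂ)) *
          ∑ x : ZMod N, (ZMod.stdAddChar (x * ((v.2 : ZMod N) - (b : ZMod N))) : ℂ) := by
      rw [Finset.sum_mul_sum, Fintype.sum_prod_type]
      refine Finset.sum_congr rfl fun x _ => Finset.sum_congr rfl fun y _ => ?_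
      rw [← AddChar.map_add_eq_mul, ← AddChar.map_add_eq_mul]
      congr 1
      ring
    rw [this, hs, hs]
    simp only [sub_eq_zero, ZMod.card]
    by_cases h1 : (v.1 : ZMod N) = a <;> by_cases h2 : (v.2 : ZMod N) = b <;> simp [h1, h2]
    field_simp

/-! ### From torsion classes to one character sum: computing `G'` -/

/-- The lattice `ℤ lam + ℤ lam τ`. -/
def pairLattice (lam τ : ℂ) : Submodule ℤ ℂ := Submodule.span ℤ {lam, lam * τ}

theorem mem_pairLattice {lam τ x : ℂ} : x ∈ pairLattice lam τ ↔ ∃ v, latticePoint lam τ v = x := by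
  rw [pairLattice, Submodule.mem_span_pair]
  constructor
  · rintro ⟨c, d, h⟩
    refine ⟨(d, c), ?_⟩
    rw [← h, latticePoint, zsmul_eq_mul, zsmul_eq_mul]
    ring
  · rintro ⟨v, h⟩
    refine ⟨v.2, v.1, ?_⟩
    rw [← h, latticePoint, zsmul_eq_mul, zsmul_eq_mul]
    ring

theorem latticePoint_mem (lam τ : ℂ) (v : ℤ × ℤ) : latticePoint lam τ v ∈ pairLattice lam τ :=
  mem_pairLattice.2 ⟨v, rfl⟩

theorem latticePoint_div_sub_mem_iff {lam : ℂ} (hlam : lam ≠ 0) (τ : ℍ) {N : ℕ} [NeZero N] {w : ℂ}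
    {v₀ : ℤ × ℤ} (hw : latticePoint lam τ v₀ = N * w) (v : ℤ × ℤ) :
    latticePoint lam τ v / N - w ∈ pairLattice lam τ ↔
      (v.1 : ZMod N) = v₀.1 ∧ (v.2 : ZMod N) = v₀.2 := by
  have hN : (N : ℂ) ≠ 0 := NeZero.ne _
  have hmul : ∀ q : ℤ × ℤ, latticePoint lam τ ((N : ℤ) • q) = N * latticePoint lam τ q := fun q => by
    simp only [latticePoint, Prod.smul_fst, Prod.smul_snd, smul_eq_mul]
    push_cast
    ring
  have key : ∀ q : ℤ × ℤ, latticePoint lam τ q = latticePoint lam τ v / N - w ↔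
      v = v₀ + (N : ℤ) • q := fun q => by
    rw [← (latticePoint_injective hlam τ).eq_iff, latticePoint_add, hmul, hw, eq_sub_iff_add_eq,
      eq_div_iff hN]
    constructor <;> intro h
    · rw [← h]; ring
    · rw [h]; ring
  rw [mem_pairLattice]
  simp only [key, eq_comm (b := ((v₀.1 : ℤ) : ZMod N)), eq_comm (b := ((v₀.2 : ℤ) : ZMod N)),
    ZMod.intCast_eq_intCast_iff_dvd_sub]
  constructor
  · rintro ⟨q, rfl⟩
    exact ⟨⟨q.1, by simp⟩, ⟨q.2, by simp⟩⟩
  · rintro ⟨⟨a, ha⟩, ⟨b, hb⟩⟩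
    refine ⟨(a, b), Prod.ext ?_ ?_⟩
    · simp [← ha]
    · simp [← hb]

open Classical in
theorem exists_isTwistedContinuation_of_torsion {lam : ℂ} (hlam : lam ≠ 0) (τ : ℍ) {N : ℕ}
    [NeZero N] {w : ℂ} (hw : (N : ℂ) * w ∈ pairLattice lam τ) : ∃ F,
    IsTwistedContinuation lam τ
      (fun v => if latticePoint lam τ v / N - w ∈ pairLattice lam τ then 1 else 0) F := by
  obtain ⟨v₀, hv₀⟩ := mem_pairLattice.1 hw
  obtain ⟨F, hF⟩ := exists_isTwistedContinuation_coset hlam τ N v₀.1 v₀.2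
  exact ⟨F, hF.congr fun v => by
    simp only [latticePoint_div_sub_mem_iff hlam τ hv₀]⟩

open Classical in
theorem IsTwistedContinuation.isHeckeContinuation {lam : ℂ} (hlam : lam ≠ 0) (τ : ℍ) {N : ℕ}
    [NeZero N] {w : ℂ} (hw : (N : ℂ) * w ∈ pairLattice lam τ) {F : ℂ → ℂ}
    (hF : IsTwistedContinuation lam τ
      (fun v => if latticePoint lam τ v / N - w ∈ pairLattice lam τ then 1 else 0) F) :
    IsHeckeContinuation N (pairLattice lam τ) w F := by
  refine ⟨-(1 / 2), by norm_num, hF.differentiableOn, fun s hs => ?_⟩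
  have hN : (N : ℂ) ≠ 0 := NeZero.ne _
  have h := hF.hasSum s hs
  have key : ∀ ω, ω / N - w ∈ pairLattice lam τ → ω ∈ Set.range (latticePoint lam τ) := fun ω hω => by
    have h1 := Submodule.add_mem _ (Submodule.smul_mem _ (N : ℤ) hω) hw
    rw [zsmul_eq_mul] at h1
    refine mem_pairLattice.1 (?_ : ω ∈ _)
    convert h1 using 1
    push_cast
    field_simp
    ring
  change HasSum ((fun ω => heckeTerm s ω) ∘ (Subtype.val : HeckeIndex N (pairLattice lam τ) w → ℂ))
    (F s)
  rw [hasSum_subtype_iff_indicator, ← (latticePoint_injective hlam τ).hasSum_iff fun ω hω =>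
    Set.indicator_of_notMem (fun hm => hω (key ω hm.2)) _]
  refine hasSum_of_eq h (fun v => ?_) rfl
  simp only [Function.comp, Set.indicator, HeckeIndex, Set.mem_ofPred_eq]
  -- Hecke's index set omits `ω = 0`; this costs nothing since `heckeTerm s 0 = 0`.
  by_cases h0 : latticePoint lam τ v = 0
  · simp [h0]
  · by_cases h1 : latticePoint lam τ v / N - w ∈ pairLattice lam τ <;> simp [h0, h1]

theorem wedge_mul_mul (lam τ : ℂ) (a b c d : ℝ) :
    wedge (lam * (b * τ + a)) (lam * (d * τ + c)) = Complex.normSq lam * τ.im * (a * d - b * c) := by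
  simp only [wedge, Complex.normSq_apply, Complex.mul_re, Complex.mul_im, Complex.add_re,
    Complex.add_im, Complex.ofReal_re, Complex.ofReal_im]
  ring

theorem wedge_latticePoint (lam τ : ℂ) (v w : ℤ × ℤ) :
    wedge (latticePoint lam τ v) (latticePoint lam τ w) =
      Complex.normSq lam * τ.im * ((v.2 * w.1 - v.1 * w.2 : ℤ) : ℝ) := by
  have := wedge_mul_mul lam τ v.2 v.1 w.2 w.1
  push_cast at this ⊢
  exact this

theorem wedge_add_right (x y z : ℂ) : wedge x (y + z) = wedge x y + wedge x z := by
  simp only [wedge, Complex.add_re, Complex.add_im]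
  ring

theorem wedge_natCast_mul (N : ℕ) (x y : ℂ) : wedge (N * x) y = N * wedge x y := by
  simp [wedge]
  ring

theorem wedge_div_natCast (N : ℕ) (x y : ℂ) : wedge x (y / N) = wedge x y / N := by
  simp [wedge, Complex.div_natCast_re, Complex.div_natCast_im]
  ring

theorem normSq_mul_im_pos {lam : ℂ} (hlam : lam ≠ 0) (τ : ℍ) :
    0 < Complex.normSq lam * (τ : ℂ).im :=
  mul_pos (Complex.normSq_pos.2 hlam) τ.im_pos

/-- On the lattice, `wedge` takes values in the integer multiples of `|lam|² Im τ`, and the basis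
`lam`, `lam τ` attains this value. -/
theorem latticeOrientation_pairLattice {lam : ℂ} (hlam : lam ≠ 0) (τ : ℍ) :
    latticeOrientation (pairLattice lam τ) = Complex.normSq lam * (τ : ℂ).im := by
  have hA := normSq_mul_im_pos hlam τ
  refine IsLeast.csInf_eq ⟨⟨hA, _, latticePoint_mem lam τ (0, 1), _, latticePoint_mem lam τ (1, 0),
    ?_⟩, ?_⟩
  · rw [wedge_latticePoint]; simp
  · rintro r ⟨hr, x, hx, y, hy, rfl⟩
    obtain ⟨v, rfl⟩ := mem_pairLattice.1 hx
    obtain ⟨w, rfl⟩ := mem_pairLattice.1 hy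
    rw [wedge_latticePoint] at hr ⊢
    have h1 : (0 : ℝ) < ((v.2 * w.1 - v.1 * w.2 : ℤ) : ℝ) := pos_of_mul_pos_right hr hA.le
    have h2 : (1 : ℝ) ≤ ((v.2 * w.1 - v.1 * w.2 : ℤ) : ℝ) := by
      exact_mod_cast Int.cast_pos.1 h1
    exact le_mul_of_one_le_right hA.le h2

theorem latticeChar_add (N : ℕ) (L : Submodule ℤ ℂ) (u v w : ℂ) :
    latticeChar N L u (v + w) = latticeChar N L u v * latticeChar N L u w := by
  rw [latticeChar, latticeChar, latticeChar, ← Complex.exp_add, wedge_add_right]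
  push_cast
  ring_nf

theorem latticeChar_eq_one {lam : ℂ} (hlam : lam ≠ 0) (τ : ℍ) {N : ℕ} {u w : ℂ}
    (hu : (N : ℂ) * u ∈ pairLattice lam τ) (hw : w ∈ pairLattice lam τ) :
    latticeChar N (pairLattice lam τ) u w = 1 := by
  obtain ⟨p, hp⟩ := mem_pairLattice.1 hu
  obtain ⟨q, rfl⟩ := mem_pairLattice.1 hw
  have hA := (normSq_mul_im_pos hlam τ).ne'
  rw [latticeChar, ← mul_div_assoc, ← wedge_natCast_mul, ← hp, wedge_latticePoint,
    latticeOrientation_pairLattice hlam, mul_div_cancel_left₀ _ hA, Complex.exp_eq_one_iff]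
  exact ⟨p.2 * q.1 - p.1 * q.2, by push_cast; ring⟩

theorem latticeChar_latticePoint_div {lam : ℂ} (hlam : lam ≠ 0) (τ : ℍ) {N : ℕ} [NeZero N]
    (a b : ℝ) (v : ℤ × ℤ) :
    latticeChar N (pairLattice lam τ) (lam * (b * τ + a)) (latticePoint lam τ v / N) =
      Complex.exp (2 * Real.pi * Complex.I * (a * v.1 - b * v.2)) := by
  have hA := (normSq_mul_im_pos hlam τ).ne'
  have hN : (N : ℝ) ≠ 0 := NeZero.ne _
  have h := wedge_mul_mul lam τ a b v.2 v.1
  simp only [Complex.ofReal_intCast] at h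
  rw [latticeChar, wedge_div_natCast, latticePoint, h, latticeOrientation_pairLattice hlam]
  congr 2
  rw [show (N : ℝ) * (Complex.normSq lam * (τ : ℂ).im * (a * v.1 - b * v.2) / N /
    (Complex.normSq lam * (τ : ℂ).im)) = a * v.1 - b * v.2 by
      generalize Complex.normSq lam * (τ : ℂ).im = A at hA ⊢
      field_simp]
  push_cast
  ring

theorem finite_torsion {lam : ℂ} (τ : ℂ) {N : ℕ} [NeZero N] :
    Finite {c : ℂ ⧸ pairLattice lam τ // (N : ℤ) • c = 0} := by
  have hN : (N : ℂ) ≠ 0 := NeZero.ne _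
  have hN' : (0 : ℤ) < N := by exact_mod_cast Nat.pos_of_neZero N
  refine Set.Finite.subset (Set.finite_range fun p : Fin N × Fin N =>
    (Submodule.Quotient.mk (latticePoint lam τ (((p.1 : ℕ) : ℤ), ((p.2 : ℕ) : ℤ)) / N) :
      ℂ ⧸ pairLattice lam τ)) ?_
  intro c hc
  obtain ⟨w, rfl⟩ := Submodule.Quotient.mk_surjective _ c
  replace hc : (N : ℤ) • (Submodule.Quotient.mk w : ℂ ⧸ pairLattice lam τ) = 0 := hc
  rw [← Submodule.Quotient.mk_smul, Submodule.Quotient.mk_eq_zero, zsmul_eq_mul] at hc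
  obtain ⟨v, hv⟩ := mem_pairLattice.1 hc
  have hlt : ∀ x : ℤ, (x % N).toNat < N := fun x => by
    have := Int.emod_nonneg x hN'.ne'
    have := Int.emod_lt_of_pos x hN'
    omega
  refine ⟨(⟨_, hlt v.1⟩, ⟨_, hlt v.2⟩), ?_⟩
  simp only [Int.toNat_of_nonneg (Int.emod_nonneg _ hN'.ne')]
  rw [Submodule.Quotient.eq]
  refine mem_pairLattice.2 ⟨(-(v.1 / N), -(v.2 / N)), ?_⟩
  have h1 : w = latticePoint lam τ v / N := by rw [hv]; push_cast; field_simp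
  have e1 : ((v.1 : ℤ) : ℂ) = (v.1 % N : ℤ) + N * (v.1 / N : ℤ) := by
    exact_mod_cast (Int.emod_add_mul_ediv v.1 N).symm
  have e2 : ((v.2 : ℤ) : ℂ) = (v.2 % N : ℤ) + N * (v.2 / N : ℤ) := by
    exact_mod_cast (Int.emod_add_mul_ediv v.2 N).symm
  rw [h1]
  simp only [latticePoint]
  rw [e1, e2]
  push_cast
  field_simp
  ring

/-- For fixed `v`, only the class of `latticePoint lam τ v / N` survives in the finite sum over
torsion classes, so that sum of coset series is the series twisted by the character. Both sides
continue the same series, and continuations agree at `0`. -/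
theorem heckeG'_eq {lam : ℂ} (hlam : lam ≠ 0) (τ : ℍ) {N : ℕ} [NeZero N] {u : ℂ}
    (hu : (N : ℂ) * u ∈ pairLattice lam τ) {F : ℂ → ℂ}
    (hF : IsTwistedContinuation lam τ
      (fun v => latticeChar N (pairLattice lam τ) u (latticePoint lam τ v / N)) F) :
    heckeG' N (pairLattice lam τ) u = F 0 := by
  classical
  set L := pairLattice lam τ with hL
  have hN : (N : ℂ) ≠ 0 := NeZero.ne _
  have := finite_torsion (lam := lam) (τ : ℂ) (N := N)
  have := Fintype.ofFinite {c : ℂ ⧸ L // (N : ℤ) • c = 0}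
  have hmk : ∀ c : ℂ ⧸ L, Submodule.Quotient.mk (Quotient.out c) = c := Quotient.out_eq'
  have ht : ∀ c : {c : ℂ ⧸ L // (N : ℤ) • c = 0}, (N : ℂ) * Quotient.out c.1 ∈ L := fun c => by
    have h := c.2
    rw [← hmk c.1, ← Submodule.Quotient.mk_smul, Submodule.Quotient.mk_eq_zero,
      zsmul_eq_mul] at h
    exact_mod_cast h
  choose G hG using fun c => exists_isTwistedContinuation_of_torsion hlam τ (ht c)
  have hval : ∀ c, heckeG N L (Quotient.out c.1) = G c 0 := fun c =>
    ((hG c).isHeckeContinuation hlam τ (ht c)).heckeG_eq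
  have hsum := IsTwistedContinuation.sum (t := Finset.univ) fun c _ =>
    (hG c).const_mul (latticeChar N L u (Quotient.out c.1))
  have heq : heckeG' N L u = ∑ c : {c : ℂ ⧸ L // (N : ℤ) • c = 0},
      latticeChar N L u (Quotient.out c.1) * G c 0 := by
    rw [heckeG', finsum_eq_sum_of_fintype]
    exact Finset.sum_congr rfl fun c _ => by rw [← hval c]
  rw [heq]
  refine (hsum.congr fun v => ?_).eq_at_zero hF
  have hc₀ : (N : ℤ) • (Submodule.Quotient.mk (latticePoint lam τ v / N) : ℂ ⧸ L) = 0 := by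
    rw [← Submodule.Quotient.mk_smul, Submodule.Quotient.mk_eq_zero, zsmul_eq_mul,
      Int.cast_natCast, mul_div_cancel₀ _ hN]
    exact latticePoint_mem lam τ v
  rw [Finset.sum_eq_single_of_mem (⟨_, hc₀⟩ : {c : ℂ ⧸ L // (N : ℤ) • c = 0}) (Finset.mem_univ _)]
  · set w := Quotient.out (Submodule.Quotient.mk (latticePoint lam τ v / N) : ℂ ⧸ L) with hw
    have hmem : latticePoint lam τ v / N - w ∈ L := (Submodule.Quotient.eq L).1 (hmk _).symm
    -- Passing from the chosen representative `w` to the point itself is harmless: as `N u ∈ L`, the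
    -- character is trivial on `L`.
    rw [if_pos hmem, mul_one, ← add_sub_cancel w (latticePoint lam τ v / N), latticeChar_add,
      latticeChar_eq_one hlam τ hu hmem, mul_one]
  · intro c _ hc
    rw [if_neg, mul_zero]
    intro hmem
    exact hc (Subtype.ext (((Submodule.Quotient.eq L).2 hmem).trans (hmk c.1)).symm)

/-! ### Fourier series and the inner sums over `c` -/

/-- `exp (2πi z)`. -/
def expTwoPiI (z : ℂ) : ℂ := Complex.exp (2 * Real.pi * Complex.I * z)

theorem expTwoPiI_add (z w : ℂ) : expTwoPiI (z + w) = expTwoPiI z * expTwoPiI w := by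
  rw [expTwoPiI, expTwoPiI, expTwoPiI, ← Complex.exp_add, mul_add]

@[simp] theorem expTwoPiI_zero : expTwoPiI 0 = 1 := by simp [expTwoPiI]

theorem expTwoPiI_ne_zero (z : ℂ) : expTwoPiI z ≠ 0 := Complex.exp_ne_zero _

theorem expTwoPiI_neg (z : ℂ) : expTwoPiI (-z) = (expTwoPiI z)⁻¹ := by
  rw [expTwoPiI, expTwoPiI, ← Complex.exp_neg, mul_neg]

theorem expTwoPiI_nat_mul (n : ℕ) (z : ℂ) : expTwoPiI (n * z) = expTwoPiI z ^ n := by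
  rw [expTwoPiI, expTwoPiI, ← Complex.exp_nat_mul]
  ring_nf

theorem expTwoPiI_int (n : ℤ) : expTwoPiI n = 1 := by
  rw [expTwoPiI, Complex.exp_eq_one_iff]
  exact ⟨n, by ring⟩

theorem expTwoPiI_eq_one_iff {z : ℂ} : expTwoPiI z = 1 ↔ ∃ n : ℤ, z = n := by
  rw [expTwoPiI, Complex.exp_eq_one_iff]
  refine exists_congr fun n => ?_
  rw [mul_comm (n : ℂ), mul_right_inj' Complex.two_pi_I_ne_zero]

theorem continuous_expTwoPiI : Continuous expTwoPiI := by
  unfold expTwoPiI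
  fun_prop

theorem norm_expTwoPiI (z : ℂ) : ‖expTwoPiI z‖ = Real.exp (-2 * Real.pi * z.im) := by
  rw [expTwoPiI, Complex.norm_exp]
  simp

theorem fourier_coe_one (n : ℤ) (x : ℝ) :
    (fourier n (x : AddCircle (1 : ℝ)) : ℂ) = expTwoPiI (n * x) := by
  rw [fourier_coe_apply, expTwoPiI]
  push_cast
  ring_nf

/-- The Fourier series of `(e(x) - 1)² g(x)` on `[0, 1)`, where `e(x) = exp(2πix)`. -/
theorem hasSum_second_difference {g : ℝ → ℂ} (hg : Continuous g) {a : ℤ → ℂ}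
    (ha : ∀ c : ℤ, ∫ x in (0 : ℝ)..1, expTwoPiI (c * x) * g x = a c)
    (hs : Summable fun c => a (c + 2) - 2 * a (c + 1) + a c) {x : ℝ} (hx : x ∈ Set.Ico (0 : ℝ) 1) :
    HasSum (fun c : ℤ => expTwoPiI (-(x * c)) * (a (c + 2) - 2 * a (c + 1) + a c))
      ((expTwoPiI x - 1) ^ 2 * g x) := by
  set H : ℝ → ℂ := fun x => (expTwoPiI x - 1) ^ 2 * g x with hH
  have hHc : Continuous H :=
    (((continuous_expTwoPiI.comp Complex.continuous_ofReal).sub continuous_const).pow 2).mul hg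
  -- The factor `(e(x) - 1)²` vanishes at both ends, so `H` descends to a continuous function on the
  -- circle even though `g` need not; summable coefficients then give pointwise convergence.
  have h01 : H 0 = H (0 + 1) := by
    have := expTwoPiI_int 1
    simp only [Int.cast_one] at this
    simp [hH, this]
  let f : C(AddCircle (1 : ℝ), ℂ) :=
    ⟨AddCircle.liftIco 1 0 H, AddCircle.liftIco_continuous h01 hHc.continuousOn⟩
  have hcoef : ∀ c : ℤ, fourierCoeff f (-c) = a (c + 2) - 2 * a (c + 1) + a c := fun c => by
    have h1 : fourierCoeff f (-c) = ∫ x in (0 : ℝ)..1, expTwoPiI (c * x) * H x := by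
      change fourierCoeff (AddCircle.liftIco 1 0 H) (-c) = _
      rw [fourierCoeff_liftIco_eq, fourierCoeffOn_eq_integral]
      simp only [neg_neg, zero_add, sub_zero, div_one, one_smul, smul_eq_mul]
      exact intervalIntegral.integral_congr fun x _ => by
        have := fourier_coe_one c x
        simp only [fourier_coe_apply, expTwoPiI] at this ⊢
        rw [← this]
        simp
    have hi : ∀ c : ℤ, IntervalIntegrable (fun x : ℝ => expTwoPiI (c * x) * g x)
        MeasureTheory.volume 0 1 := fun c =>
      ((continuous_expTwoPiI.comp (by fun_prop)).mul hg).intervalIntegrable _ _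
    rw [h1, ← ha, ← ha, ← ha, ← intervalIntegral.integral_const_mul,
      ← intervalIntegral.integral_sub (hi _) ((hi _).const_mul _),
      ← intervalIntegral.integral_add ((hi _).sub ((hi _).const_mul _)) (hi _)]
    refine intervalIntegral.integral_congr fun x _ => ?_
    have e1 : expTwoPiI (((c + 1 : ℤ) : ℂ) * x) = expTwoPiI (c * x) * expTwoPiI x := by
      rw [← expTwoPiI_add]; push_cast; ring_nf
    have e2 : expTwoPiI (((c + 2 : ℤ) : ℂ) * x) = expTwoPiI (c * x) * expTwoPiI x ^ 2 := by
      rw [sq, ← expTwoPiI_add, ← expTwoPiI_add]; push_cast; ring_nf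
    simp only [e1, e2, hH]
    ring
  have hsum : Summable (fourierCoeff f) := by
    rw [← (Equiv.neg ℤ).summable_iff]
    exact hs.congr fun c => (hcoef c).symm
  have key := has_pointwise_sum_fourier_series_of_summable hsum (x : AddCircle (1 : ℝ))
  rw [← (Equiv.neg ℤ).hasSum_iff] at key
  have hfx : f (x : AddCircle (1 : ℝ)) = H x :=
    AddCircle.liftIco_coe_apply (p := (1 : ℝ)) (a := 0) (f := H) (by simpa using hx)
  rw [hfx] at key
  refine hasSum_of_eq key (fun c => ?_) rfl
  simp only [Function.comp, Equiv.neg_apply, hcoef, fourier_coe_one, smul_eq_mul]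
  rw [mul_comm]
  push_cast
  ring_nf

theorem integral_expTwoPiI_mul {w : ℂ} (hw : w ≠ 0) :
    ∫ x in (0 : ℝ)..1, expTwoPiI (w * x) = (expTwoPiI w - 1) / (2 * Real.pi * Complex.I * w) := by
  have := integral_exp_mul_complex (a := 0) (b := 1)
    (mul_ne_zero Complex.two_pi_I_ne_zero hw)
  simp only [expTwoPiI, ← mul_assoc]
  rw [this]
  simp

/-- The value of `∑ e(-xc) (z + c)⁻¹`, summed over `c ∈ ℤ` in the sense of Hecke, for `0 < x < 1`;
the term `c = 0` is omitted if `z = 0`. -/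
def lerchValue (x : ℝ) (z : ℂ) : ℂ :=
  if z = 0 then 2 * Real.pi * Complex.I * (x - 1 / 2)
  else 2 * Real.pi * Complex.I * (expTwoPiI (x * z) / (expTwoPiI z - 1))

/-- This includes `c = 0`, where the integral is `0` and `0⁻¹ = 0`; that convention is what drops
the term `ω = 0` from the row `d = 0`. -/
theorem integral_bernoulli (c : ℤ) :
    ∫ x in (0 : ℝ)..1, expTwoPiI (c * x) * ((x : ℂ) - 1 / 2) =
      (2 * Real.pi * Complex.I)⁻¹ * (c : ℂ)⁻¹ := by
  have h1 : ∫ x in (0 : ℝ)..1, expTwoPiI (c * x) * ((x : ℂ) - 1 / 2) =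
      bernoulliFourierCoeff 1 (-c) := by
    rw [bernoulliFourierCoeff, fourierCoeffOn_eq_integral]
    simp only [neg_neg, sub_zero, div_one, one_smul, smul_eq_mul]
    refine intervalIntegral.integral_congr fun x _ => ?_
    have := fourier_coe_one c x
    simp only [fourier_coe_apply, expTwoPiI] at this ⊢
    rw [← this, bernoulliFun_one]
    simp
  rw [h1]
  rcases eq_or_ne c 0 with rfl | hc
  · simp [bernoulliFourierCoeff_zero]
  · rw [bernoulliFourierCoeff_eq one_ne_zero]
    have : (c : ℂ) ≠ 0 := by exact_mod_cast hc
    have := Complex.two_pi_I_ne_zero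
    simp
    field_simp

/-- Up to a constant factor, `(z + c)⁻¹` is the Fourier coefficient of `e(xz)` on `[0, 1)`, or of `x
- 1/2` if `z = 0`. The hypothesis on `z` ensures that no denominator vanishes in the first case. -/
theorem hasSum_lerchValue {z : ℂ} (hz : z ≠ 0 → ∀ n : ℤ, z ≠ n)
    (hs : Summable fun c : ℤ => (z + (c + 2))⁻¹ - 2 * (z + (c + 1))⁻¹ + (z + c)⁻¹)
    {x : ℝ} (hx : x ∈ Set.Ico (0 : ℝ) 1) :
    HasSum (fun c : ℤ => expTwoPiI (-(x * c)) *
      ((z + (c + 2))⁻¹ - 2 * (z + (c + 1))⁻¹ + (z + c)⁻¹))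
      ((expTwoPiI x - 1) ^ 2 * lerchValue x z) := by
  have hpi := Complex.two_pi_I_ne_zero
  rcases eq_or_ne z 0 with rfl | hz0
  · have := hasSum_second_difference (g := fun x : ℝ => (x : ℂ) - 1 / 2) (by fun_prop)
      (a := fun c => (2 * Real.pi * Complex.I)⁻¹ * (c : ℂ)⁻¹) integral_bernoulli
      ((hs.mul_left (2 * Real.pi * Complex.I)⁻¹).congr fun c => by push_cast; ring_nf) hx
    refine hasSum_of_eq (this.mul_left (2 * Real.pi * Complex.I)) (fun c => ?_) ?_
    · push_cast
      simp only [zero_add]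
      field_simp
    · rw [lerchValue, if_pos rfl]
      ring
  · have hz1 : expTwoPiI z - 1 ≠ 0 := sub_ne_zero.2 fun h => by
      obtain ⟨n, hn⟩ := expTwoPiI_eq_one_iff.1 h
      exact hz hz0 n hn
    set K := (expTwoPiI z - 1) / (2 * Real.pi * Complex.I) with hK
    have hK0 : K ≠ 0 := div_ne_zero hz1 hpi
    have := hasSum_second_difference (g := fun x : ℝ => expTwoPiI (x * z))
      (continuous_expTwoPiI.comp (by fun_prop)) (a := fun c => K * (z + c)⁻¹) (fun c => by
        have hw : z + c ≠ 0 := fun h => hz hz0 (-c) (by push_cast; linear_combination h)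
        simp only [← expTwoPiI_add]
        simp only [show ∀ x : ℝ, (c : ℂ) * x + x * z = (z + c) * x from fun x => by ring]
        rw [integral_expTwoPiI_mul hw, expTwoPiI_add, expTwoPiI_int, mul_one, hK]
        field_simp)
      ((hs.mul_left K).congr fun c => by push_cast; ring_nf) hx
    refine hasSum_of_eq (this.mul_left K⁻¹) (fun c => ?_) ?_
    · push_cast
      field_simp
    · rw [lerchValue, if_neg hz0, hK]
      field_simp

/-! ### Summation by rows at `s = 0` -/

theorem heckeDiff₂_zero_latticePoint (lam τ : ℂ) (v : ℤ × ℤ) :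
    heckeDiff₂ 0 (latticePoint lam τ v) (latticePoint lam τ (0, 1)) =
      lam⁻¹ * ((v.1 * τ + (v.2 + 2))⁻¹ - 2 * (v.1 * τ + (v.2 + 1))⁻¹ + (v.1 * τ + v.2)⁻¹) := by
  simp only [heckeDiff₂, heckeTerm_zero_left]
  rw [show latticePoint lam τ v + 2 * latticePoint lam τ (0, 1) = lam * (v.1 * τ + (v.2 + 2)) by
    simp only [latticePoint]; push_cast; ring,
    show latticePoint lam τ v + latticePoint lam τ (0, 1) = lam * (v.1 * τ + (v.2 + 1)) by
    simp only [latticePoint]; push_cast; ring, latticePoint, mul_inv, mul_inv, mul_inv]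
  ring

theorem summable_second_difference_inv (τ : ℍ) (d : ℤ) :
    Summable fun c : ℤ => ((d * τ : ℂ) + (c + 2))⁻¹ - 2 * ((d * τ : ℂ) + (c + 1))⁻¹ +
      ((d * τ : ℂ) + c)⁻¹ := by
  have h := summable_heckeDiff₂ one_ne_zero τ (latticePoint 1 τ (0, 1)) (s := 0) (by simp)
    (ψ := fun _ => 1) (by simp)
  simp only [heckeDiff₂_zero_latticePoint, one_mul, inv_one] at h
  exact h.prod_factor d

theorem int_mul_coe_ne_intCast (τ : ℍ) (d : ℤ) (h : (d * τ : ℂ) ≠ 0) (n : ℤ) :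
    (d * τ : ℂ) ≠ n := fun h' => by
  have him := congrArg Complex.im h'
  have : d = 0 := by simpa [τ.im_ne_zero] using him
  simp [this] at h

/-- `G'` as a sum over `d` of the values of the inner sums over `c`. -/
theorem hasSum_lerchValue_heckeG' {lam : ℂ} (hlam : lam ≠ 0) (τ : ℍ) {N : ℕ} [NeZero N] {a b x : ℝ}
    (hx : x ∈ Set.Ioo (0 : ℝ) 1) (hb : ∀ c : ℤ, expTwoPiI (-(b * c)) = expTwoPiI (-(x * c)))
    (hu : (N : ℂ) * (lam * (b * τ + a)) ∈ pairLattice lam τ) :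
    HasSum (fun d : ℤ => expTwoPiI (a * d) * lerchValue x (d * τ))
      (lam * heckeG' N (pairLattice lam τ) (lam * (b * τ + a))) := by
  have hζ : expTwoPiI x ≠ 1 := fun h => by
    obtain ⟨n, hn⟩ := expTwoPiI_eq_one_iff.1 h
    have hn' : x = n := by exact_mod_cast hn
    rw [hn'] at hx
    have h1 : (0 : ℤ) < n := by exact_mod_cast hx.1
    have h2 : n < (1 : ℤ) := by exact_mod_cast hx.2
    omega
  set ψ : ℤ × ℤ → ℂ := fun v => expTwoPiI (a * v.1) * expTwoPiI (-(x * v.2)) with hψdef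
  have hψ : ∀ v, ‖ψ v‖ ≤ 1 := fun v => by simp [hψdef, norm_expTwoPiI]
  have htr : ∀ v, ψ (v + (0, 1)) = (expTwoPiI x)⁻¹ * ψ v := fun v => by
    simp only [hψdef, ← expTwoPiI_neg, ← expTwoPiI_add, Prod.fst_add, Prod.snd_add]
    push_cast
    ring_nf
  have hcont := isTwistedContinuation_of_translate hlam τ hψ (v₀ := (0, 1))
    (ζ := (expTwoPiI x)⁻¹) (by simpa using hζ) (inv_ne_zero (expTwoPiI_ne_zero _)) htr
  have hval := heckeG'_eq hlam τ hu (hcont.congr fun v => by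
    rw [latticeChar_latticePoint_div hlam, hψdef]
    simp only [← hb, ← expTwoPiI_add]
    rw [expTwoPiI, sub_eq_add_neg])
  have hne : (expTwoPiI x - 1) ^ 2 ≠ 0 := pow_ne_zero 2 (sub_ne_zero.2 hζ)
  have hs := (summable_heckeDiff₂ hlam τ (latticePoint lam τ (0, 1)) (s := 0) (by simp)
    hψ).hasSum
  -- Absolute convergence permits summing over `c` first. Each row carries the factor `(e(x) - 1)²`,
  -- which cancels the constant introduced by Abel summation.
  have hfib := (hs.prod_fiberwise fun d => by
    simp only [heckeDiff₂_zero_latticePoint, hψdef]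
    exact hasSum_of_eq ((hasSum_lerchValue (int_mul_coe_ne_intCast τ d)
      (summable_second_difference_inv τ d) ⟨hx.1.le, hx.2⟩).mul_left (expTwoPiI (a * d) * lam⁻¹))
      (fun c => by ring) rfl).mul_left (((expTwoPiI x - 1) ^ 2)⁻¹ * lam)
  refine hasSum_of_eq hfib (fun d => ?_) ?_
  · field_simp
  · rw [hval, inv_inv]
    ring

/-! ### Geometric expansion of the rows and sums over divisors -/

theorem lerchValue_pos {τ : ℍ} {N r : ℕ} [NeZero N] {d : ℕ} (hd : d ≠ 0) :
    lerchValue (r / N : ℝ) ((d : ℤ) * τ) = -(2 * Real.pi * Complex.I) *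
      ((expTwoPiI (τ / N) ^ d) ^ r / (1 - (expTwoPiI (τ / N) ^ d) ^ N)) := by
  have hN : (N : ℂ) ≠ 0 := NeZero.ne _
  have h0 : ((d : ℤ) * τ : ℂ) ≠ 0 := mul_ne_zero (by exact_mod_cast hd) τ.ne_zero
  rw [lerchValue, if_neg h0, ← expTwoPiI_nat_mul, ← expTwoPiI_nat_mul, ← expTwoPiI_nat_mul,
    show (N : ℂ) * (d * (τ / N)) = (d : ℤ) * τ by push_cast; field_simp,
    show (r : ℂ) * (d * (τ / N)) = ((r / N : ℝ) : ℂ) * ((d : ℤ) * τ) by push_cast; field_simp,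
    ← neg_sub (1 : ℂ), div_neg]
  ring

/-- Numerator and denominator are multiplied by `Y ^ N`, with `Y = expTwoPiI (τ / N) ^ d`, so that
only powers of norm less than `1` remain. This turns the residue `r` into `N - r`, that is, `-r`. -/
theorem lerchValue_neg {τ : ℍ} {N r : ℕ} [NeZero N] (hr : r ≤ N) {d : ℕ} (hd : d ≠ 0) :
    lerchValue (r / N : ℝ) ((-(d : ℤ) : ℤ) * τ) = 2 * Real.pi * Complex.I *
      ((expTwoPiI (τ / N) ^ d) ^ (N - r) / (1 - (expTwoPiI (τ / N) ^ d) ^ N)) := by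
  have hN : (N : ℂ) ≠ 0 := NeZero.ne _
  have h0 : ((-(d : ℤ) : ℤ) * τ : ℂ) ≠ 0 := by
    push_cast
    exact mul_ne_zero (neg_ne_zero.2 (Nat.cast_ne_zero.2 hd)) τ.ne_zero
  have hY : expTwoPiI (τ / N) ^ d ≠ 0 := pow_ne_zero _ (expTwoPiI_ne_zero _)
  rw [lerchValue, if_neg h0,
    show ((-(d : ℤ) : ℤ) * τ : ℂ) = -((N : ℂ) * (d * (τ / N))) by push_cast; field_simp,
    show ((r / N : ℝ) : ℂ) * -((N : ℂ) * (d * (τ / N))) = -((r : ℂ) * (d * (τ / N))) by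
      push_cast; field_simp,
    pow_sub₀ _ hY hr]
  simp only [expTwoPiI_neg, expTwoPiI_nat_mul]
  generalize expTwoPiI (τ / N) ^ d = Y at hY ⊢
  congr 1
  have h1 : (Y ^ N)⁻¹ - 1 = (Y ^ N)⁻¹ * (1 - Y ^ N) := by field_simp
  rw [h1, div_mul_eq_div_div, div_inv_eq_mul, mul_comm (Y ^ r)⁻¹]

theorem hasSum_pow_progression {N r : ℕ} (hr : 0 < r) (hrN : r ≤ N) {Y : ℂ} (hY : ‖Y‖ < 1) :
    HasSum (fun m : ℕ+ => if (m : ℤ) ≡ r [ZMOD N] then Y ^ (m : ℕ) else 0)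
      (Y ^ r / (1 - Y ^ N)) := by
  have hN : N ≠ 0 := by omega
  let i : ℕ → ℕ+ := fun k => ⟨r + k * N, by positivity⟩
  have hi : Function.Injective i := fun k l h => by
    have h1 : r + k * N = r + l * N := congrArg PNat.val h
    exact Nat.eq_of_mul_eq_mul_right (Nat.pos_of_ne_zero hN) (by omega)
  rw [← hi.hasSum_iff]
  · have h1 : ‖Y ^ N‖ < 1 := by
      rw [norm_pow]
      exact pow_lt_one₀ (norm_nonneg _) hY hN
    refine hasSum_of_eq ((hasSum_geometric_of_norm_lt_one h1).mul_left (Y ^ r)) (fun k => ?_)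
      (div_eq_mul_inv _ _)
    simp only [Function.comp]
    rw [if_pos]
    · simp only [i, PNat.mk_coe]
      ring
    · simp only [i, PNat.mk_coe]
      push_cast
      simp [Int.modEq_iff_dvd]
  · intro m hm
    refine if_neg fun h => hm ?_
    obtain ⟨k, hk⟩ := h.symm.dvd
    have hm0 : (0 : ℤ) < m := by exact_mod_cast m.pos
    -- With `m = r + N k` and `r ≤ N`, a negative `k` would give `m ≤ 0`.
    have hk0 : 0 ≤ k := by
      by_contra hneg
      have : (N : ℤ) * k ≤ N * (-1) := mul_le_mul_of_nonneg_left (by omega) (by omega)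
      omega
    lift k to ℕ using hk0
    refine ⟨k, PNat.eq ?_⟩
    simp only [i, PNat.mk_coe]
    zify
    linarith

/-- The multiplicity with sign of `±m ≡ ℓ mod N`. -/
def signedIndicator (N : ℕ) (ℓ : ℤ) (m : ℕ) : ℂ :=
  (if (m : ℤ) ≡ ℓ [ZMOD N] then 1 else 0) - if -(m : ℤ) ≡ ℓ [ZMOD N] then 1 else 0

theorem norm_signedIndicator_le (N : ℕ) (ℓ : ℤ) (m : ℕ) : ‖signedIndicator N ℓ m‖ ≤ 1 := by
  unfold signedIndicator
  split_ifs <;> simp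

theorem hasSum_signedIndicator_mul_pow {N r : ℕ} {ℓ : ℤ} (hr : 0 < r) (hrN : r < N)
    (hℓ : (r : ℤ) ≡ ℓ [ZMOD N]) {Y : ℂ} (hY : ‖Y‖ < 1) :
    HasSum (fun m : ℕ+ => signedIndicator N ℓ m * Y ^ (m : ℕ))
      (Y ^ r / (1 - Y ^ N) - Y ^ (N - r) / (1 - Y ^ N)) := by
  refine hasSum_of_eq ((hasSum_pow_progression hr hrN.le hY).sub
    (hasSum_pow_progression (N := N) (r := N - r) (by omega) (by omega) hY)) (fun m => ?_) rfl
  have h1 : ((m : ℕ) : ℤ) ≡ ℓ [ZMOD N] ↔ ((m : ℕ) : ℤ) ≡ r [ZMOD N] :=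
    ⟨fun h => h.trans hℓ.symm, fun h => h.trans hℓ⟩
  have h2 : -((m : ℕ) : ℤ) ≡ ℓ [ZMOD N] ↔ ((m : ℕ) : ℤ) ≡ (N - r : ℕ) [ZMOD N] := by
    have h3 : ((N - r : ℕ) : ℤ) ≡ -ℓ [ZMOD N] := by
      rw [Nat.cast_sub hrN.le]
      have := (Int.modEq_zero_iff_dvd.2 (dvd_refl (N : ℤ))).sub hℓ
      simpa using this
    constructor <;> intro h
    · simpa using h.neg.trans h3.symm
    · simpa using (h.trans h3).neg
  simp only [signedIndicator, h1, h2]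
  split_ifs <;> simp

/-- The divisor `m` corresponds to the factorisation `n = (n/|m|) · |m|`, separately for each sign
of `m`. Evenness of `ε` absorbs the sign of `n / m`. -/
theorem sum_divisorsCongr (N : ℕ) (ℓ : ℤ) (n : ℕ+) {ε : ℤ → ℂ} (hε : ∀ d, ε (-d) = ε d) :
    ∑ m ∈ divisorsCongr N ℓ n, ε (((n : ℕ) : ℤ) / m) * (m.sign : ℂ) =
      ∑ p ∈ (n : ℕ).divisorsAntidiagonal, ε p.1 * signedIndicator N ℓ p.2 := by
  have hn : (0 : ℤ) < (n : ℕ) := by exact_mod_cast n.pos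
  simp only [signedIndicator, mul_sub, Finset.sum_sub_distrib, mul_ite, mul_one, mul_zero,
    ← Finset.sum_filter]
  rw [← Finset.sum_filter_add_sum_filter_not _ (fun m : ℤ => 0 < m), sub_eq_add_neg,
    ← Finset.sum_neg_distrib]
  congr 1
  · refine Finset.sum_nbij' (fun m => ((n : ℕ) / m.natAbs, m.natAbs)) (fun p => (p.2 : ℤ)) ?_ ?_ ?_ ?_ ?_
    · intro m hm
      simp only [divisorsCongr, Finset.mem_filter, Finset.mem_Icc, Nat.mem_divisorsAntidiagonal] at hm ⊢
      obtain ⟨⟨_, hd, hc⟩, hp⟩ := hm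
      refine ⟨⟨Nat.div_mul_cancel (by simpa using Int.natAbs_dvd_natAbs.2 hd), n.ne_zero⟩, ?_⟩
      rwa [Int.natAbs_of_nonneg hp.le]
    · intro p hp
      simp only [divisorsCongr, Finset.mem_filter, Finset.mem_Icc, Nat.mem_divisorsAntidiagonal] at hp ⊢
      obtain ⟨⟨hp, hn0⟩, hc⟩ := hp
      have hdvd : p.2 ∣ (n : ℕ) := ⟨p.1, by rw [mul_comm]; exact hp.symm⟩
      have hle := Nat.le_of_dvd n.pos hdvd
      have hpos := Nat.pos_of_dvd_of_pos hdvd n.pos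
      exact ⟨⟨⟨by omega, by omega⟩, by exact_mod_cast hdvd, hc⟩, by omega⟩
    · intro m hm
      have := (Finset.mem_filter.1 hm).2
      simp only
      omega
    · intro p hp
      obtain ⟨hp, -⟩ := Finset.mem_filter.1 hp
      obtain ⟨hp, hn0⟩ := Nat.mem_divisorsAntidiagonal.1 hp
      have : 0 < p.2 := Nat.pos_of_ne_zero fun h => hn0 (by rw [← hp, h, mul_zero])
      refine Prod.ext ?_ ?_
      · simp [← hp, this]
      · simp
    · intro m hm
      have hp := (Finset.mem_filter.1 hm).2
      simp [Int.sign_eq_one_of_pos hp, abs_of_pos hp]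
  · refine Finset.sum_nbij' (fun m => ((n : ℕ) / m.natAbs, m.natAbs)) (fun p => -(p.2 : ℤ)) ?_ ?_ ?_ ?_ ?_
    · intro m hm
      simp only [divisorsCongr, Finset.mem_filter, Finset.mem_Icc, Nat.mem_divisorsAntidiagonal] at hm ⊢
      obtain ⟨⟨_, hd, hc⟩, hp⟩ := hm
      refine ⟨⟨Nat.div_mul_cancel (by simpa using Int.natAbs_dvd_natAbs.2 hd), n.ne_zero⟩, ?_⟩
      rwa [Int.ofNat_natAbs_of_nonpos (not_lt.1 hp), neg_neg]
    · intro p hp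
      simp only [divisorsCongr, Finset.mem_filter, Finset.mem_Icc, Nat.mem_divisorsAntidiagonal] at hp ⊢
      obtain ⟨⟨hp, hn0⟩, hc⟩ := hp
      have hdvd : p.2 ∣ (n : ℕ) := ⟨p.1, by rw [mul_comm]; exact hp.symm⟩
      have hle := Nat.le_of_dvd n.pos hdvd
      exact ⟨⟨⟨by omega, by omega⟩, by rw [neg_dvd]; exact_mod_cast hdvd, hc⟩, by omega⟩
    · intro m hm
      have := (Finset.mem_filter.1 hm).2
      simp only
      omega
    · intro p hp
      obtain ⟨hp, -⟩ := Finset.mem_filter.1 hp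
      obtain ⟨hp, hn0⟩ := Nat.mem_divisorsAntidiagonal.1 hp
      have : 0 < p.2 := Nat.pos_of_ne_zero fun h => hn0 (by rw [← hp, h, mul_zero])
      refine Prod.ext ?_ ?_
      · simp [← hp, this]
      · simp
    · intro m hm
      obtain ⟨hm, hp⟩ := Finset.mem_filter.1 hm
      have hd := (Finset.mem_filter.1 hm).2.1
      have hm0 : m < 0 := lt_of_le_of_ne (not_lt.1 hp) fun h => by
        rw [h, zero_dvd_iff] at hd
        omega
      simp [Int.sign_eq_neg_one_of_neg hm0, abs_of_neg hm0, hε, Int.ediv_neg]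

theorem norm_expTwoPiI_div_lt_one (τ : ℍ) (N : ℕ) [NeZero N] : ‖expTwoPiI (τ / N)‖ < 1 := by
  have hN : (0 : ℝ) < N := by exact_mod_cast Nat.pos_of_neZero N
  have him : ((τ : ℂ) / N).im = τ.im / N := by simp [Complex.div_natCast_im]
  rw [norm_expTwoPiI, Real.exp_lt_one_iff, him]
  have := div_pos τ.im_pos hN
  nlinarith [Real.pi_pos]

/-! ### The `q`-expansion for an arbitrary scaling factor -/

/-- The `q`-expansion of `G'(L, u)` for `L = ℤ lam + ℤ lam τ` and `u = lam (ℓ τ / N + a)`. -/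
theorem hasSum_qExpansion {lam : ℂ} (hlam : lam ≠ 0) (τ : ℍ) {N : ℕ} (hN : 2 ≤ N) {ℓ : ℤ}
    (hℓ : IsCoprime ℓ (N : ℤ)) {a : ℝ} {ε : ℤ → ℂ} (hε : ∀ d, expTwoPiI (a * (d : ℤ)) = ε d)
    (hneg : ∀ d, ε (-d) = ε d)
    (hu : (N : ℂ) * (lam * (((ℓ / N : ℝ) : ℂ) * τ + a)) ∈ pairLattice lam τ) :
    HasSum (fun n : ℕ+ => (∑ m ∈ divisorsCongr N ℓ n, ε (((n : ℕ) : ℤ) / m) * (m.sign : ℂ)) *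
        Complex.exp (2 * Real.pi * Complex.I * τ * (n : ℕ) / N))
      (((Int.fract ((ℓ : ℚ) / N) - 1 / 2 : ℚ) : ℂ) - lam / (2 * Real.pi * Complex.I) *
        heckeG' N (pairLattice lam τ) (lam * (((ℓ / N : ℝ) : ℂ) * τ + a))) := by
  have : NeZero N := ⟨by omega⟩
  have hN0 : (0 : ℤ) < N := by omega
  have hNC : (N : ℂ) ≠ 0 := NeZero.ne _
  have hpi := Complex.two_pi_I_ne_zero
  obtain ⟨r, hr⟩ := Int.eq_ofNat_of_zero_le (Int.emod_nonneg ℓ hN0.ne')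
  have hrN : r < N := by
    have := Int.emod_lt_of_pos ℓ hN0
    omega
  -- If `N` divided `ℓ`, coprimality would make `ℓ` and `N` share the unit divisor `N ≥ 2`. Hence `r
  -- / N` lies strictly between `0` and `1` and the character is nontrivial in `c`.
  have hr0 : 0 < r := by
    refine Nat.pos_of_ne_zero fun h => ?_
    have hdvd : (N : ℤ) ∣ ℓ := Int.dvd_of_emod_eq_zero (by rw [hr, h]; rfl)
    have := Int.isUnit_iff.1 (hℓ.isUnit_of_dvd' hdvd dvd_rfl)
    omega
  have hmod : (r : ℤ) ≡ ℓ [ZMOD N] := by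
    rw [← hr]
    exact Int.mod_modEq ℓ N
  obtain ⟨k, hk⟩ := hmod.dvd
  have hrR : (0 : ℝ) < r := by exact_mod_cast hr0
  have hNR : (0 : ℝ) < N := by exact_mod_cast hN0
  have hx : (r / N : ℝ) ∈ Set.Ioo (0 : ℝ) 1 :=
    ⟨by positivity, by rw [div_lt_one hNR]; exact_mod_cast hrN⟩
  have hℓk : ℓ = r + N * k := by linarith
  have hfract : ((Int.fract ((ℓ : ℚ) / N) - 1 / 2 : ℚ) : ℂ) = ((r / N : ℝ) : ℂ) - 1 / 2 := by
    have hNQ : (N : ℚ) ≠ 0 := NeZero.ne _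
    have h1 : (ℓ : ℚ) / N = (r / N : ℚ) + k := by
      rw [hℓk]; push_cast; field_simp
    have h2 : Int.fract (r / N : ℚ) = r / N := Int.fract_eq_self.2
      ⟨by positivity, by rw [div_lt_one (by positivity)]; exact_mod_cast hrN⟩
    rw [h1, Int.fract_add_intCast, h2]
    push_cast
    ring
  have hb : ∀ c : ℤ, expTwoPiI (-(((ℓ / N : ℝ) : ℂ) * c)) =
      expTwoPiI (-(((r / N : ℝ) : ℂ) * c)) := fun c => by
    rw [show -(((ℓ / N : ℝ) : ℂ) * c) = -(((r / N : ℝ) : ℂ) * c) + ((-(k * c) : ℤ) : ℂ) by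
      rw [hℓk]; push_cast; field_simp; ring, expTwoPiI_add, expTwoPiI_int, mul_one]
  have hZ := hasSum_lerchValue_heckeG' hlam τ hx hb hu
  simp only [hε] at hZ
  have hε0 : ε 0 = 1 := by simpa using (hε 0).symm
  have hεn : ∀ d, ‖ε d‖ ≤ 1 := fun d => by
    rw [← hε, norm_expTwoPiI]
    simp
  set y := expTwoPiI (τ / N) with hy
  have hy1 : ‖y‖ < 1 := norm_expTwoPiI_div_lt_one τ N
  set t : ℕ+ × ℕ+ → ℂ := fun p =>
    ε ((p.1 : ℕ) : ℤ) * signedIndicator N ℓ p.2 * y ^ ((p.1 : ℕ) * (p.2 : ℕ)) with ht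
  have hsum : Summable t := by
    refine Summable.of_norm_bounded (summable_prod_mul_pow 0 (r := ‖y‖) (by simpa using hy1))
      fun p => ?_
    rw [ht, norm_mul, norm_mul, norm_pow, pow_zero, one_mul]
    exact mul_le_of_le_one_left (by positivity)
      (mul_le_one₀ (hεn _) (norm_nonneg _) (norm_signedIndicator_le _ _ _))
  have hfib := hsum.hasSum.prod_fiberwise fun d => by
    have hY : ‖y ^ (d : ℕ)‖ < 1 := by
      rw [norm_pow]
      exact pow_lt_one₀ (norm_nonneg _) hy1 d.ne_zero
    exact hasSum_of_eq ((hasSum_signedIndicator_mul_pow hr0 hrN hmod hY).mul_left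
      (ε ((d : ℕ) : ℤ))) (fun m => by simp only [ht, pow_mul, mul_assoc]) rfl
  -- Pairing `d` with `-d` counts the row `d = 0` twice, so the total is the sum plus that row.
  -- Removing the term of index `0`, which is twice that row, leaves the sum minus the row `d = 0`.
  have hnat := hZ.nat_add_neg
  rw [← hasSum_nat_add_iff' 1] at hnat
  simp only [Finset.range_one, Finset.sum_singleton] at hnat
  rw [← Equiv.pnatEquivNat.hasSum_iff] at hnat
  have hS : lam * heckeG' N (pairLattice lam τ) (lam * (((ℓ / N : ℝ) : ℂ) * τ + a)) -
      2 * Real.pi * Complex.I * (((r / N : ℝ) : ℂ) - 1 / 2) =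
      -(2 * Real.pi * Complex.I) * ∑' p, t p := by
    refine HasSum.unique (f := fun d : ℕ+ => -(2 * Real.pi * Complex.I) *
      (ε ((d : ℕ) : ℤ) * ((y ^ (d : ℕ)) ^ r / (1 - (y ^ (d : ℕ)) ^ N) -
        (y ^ (d : ℕ)) ^ (N - r) / (1 - (y ^ (d : ℕ)) ^ N)))) ?_ (hfib.mul_left _)
    refine hasSum_of_eq hnat (fun d => ?_) ?_
    · have hd : (Equiv.pnatEquivNat d) + 1 = (d : ℕ) := d.natPred_add_one
      simp only [Function.comp, hd, hneg]
      rw [lerchValue_pos d.ne_zero, lerchValue_neg hrN.le d.ne_zero]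
      ring
    · simp [lerchValue, hε0]
  have hG : ((Int.fract ((ℓ : ℚ) / N) - 1 / 2 : ℚ) : ℂ) - lam / (2 * Real.pi * Complex.I) *
      heckeG' N (pairLattice lam τ) (lam * (((ℓ / N : ℝ) : ℂ) * τ + a)) = ∑' p, t p := by
    rw [hfract]
    have : lam / (2 * Real.pi * Complex.I) *
        heckeG' N (pairLattice lam τ) (lam * (((ℓ / N : ℝ) : ℂ) * τ + a)) =
        (2 * Real.pi * Complex.I)⁻¹ * (2 * Real.pi * Complex.I * (((r / N : ℝ) : ℂ) - 1 / 2) +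
          -(2 * Real.pi * Complex.I) * ∑' p, t p) := by
      rw [← hS]
      ring
    rw [this]
    field_simp
    ring
  rw [hG]
  -- The same absolutely convergent double series is now grouped by the product `n = d m`.
  have hdiv := (sigmaAntidiagonalEquivProd.hasSum_iff.2 hsum.hasSum).sigma fun n =>
    hasSum_fintype _
  refine hasSum_of_eq hdiv (fun n => ?_) rfl
  rw [sum_divisorsCongr N ℓ n hneg, Finset.sum_mul, ← Finset.sum_coe_sort]
  refine Finset.sum_congr rfl fun p _ => ?_
  have hp := (Nat.mem_divisorsAntidiagonal.1 p.2).1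
  have hexp : Complex.exp (2 * Real.pi * Complex.I * τ * (n : ℕ) / N) = y ^ (n : ℕ) := by
    rw [hy, ← expTwoPiI_nat_mul, expTwoPiI]
    ring_nf
  rw [hexp, show y ^ (n : ℕ) = y ^ ((p : ℕ × ℕ).1 * (p : ℕ × ℕ).2) by rw [hp]]
  rfl

theorem natCast_mul_mem_pairLattice (lam τ : ℂ) {N : ℕ} [NeZero N] (ℓ : ℤ) :
    (N : ℂ) * (lam * (((ℓ / N : ℝ) : ℂ) * τ + (0 : ℝ))) ∈ pairLattice lam τ := by
  have hNC : (N : ℂ) ≠ 0 := NeZero.ne _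
  refine mem_pairLattice.2 ⟨(ℓ, 0), ?_⟩
  simp only [latticePoint]
  push_cast
  field_simp
  ring

theorem natCast_mul_mem_pairLattice_of_even (lam τ : ℂ) {N : ℕ} [NeZero N] (hN : Even N) (ℓ : ℤ) :
    (N : ℂ) * (lam * (((ℓ / N : ℝ) : ℂ) * τ + (1 / 2 : ℝ))) ∈ pairLattice lam τ := by
  have hNC : (N : ℂ) ≠ 0 := NeZero.ne _
  obtain ⟨k, hk⟩ := hN
  have hkC : (N : ℂ) = k + k := by exact_mod_cast hk
  have hℓ : (N : ℂ) * ((ℓ / N : ℝ) : ℂ) = ℓ := by push_cast; field_simp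
  refine mem_pairLattice.2 ⟨(ℓ, k), ?_⟩
  simp only [latticePoint]
  push_cast at hℓ ⊢
  linear_combination (-lam * τ) * hℓ - lam / 2 * hkC

/-- For `a = 1/2` the twist in `d` is the sign `(-1)^d`, which is even in `d` as `hasSum_qExpansion`
requires. -/
theorem expTwoPiI_half_mul (d : ℤ) : expTwoPiI (((1 / 2 : ℝ) : ℂ) * d) = (-1) ^ d := by
  rw [expTwoPiI, ← Complex.exp_pi_mul_I, ← Complex.exp_int_mul]
  push_cast
  ring_nf

theorem hasSum_qExpansion_zero {lam : ℂ} (hlam : lam ≠ 0) (τ : ℍ) {N : ℕ} (hN : 2 ≤ N) {ℓ : ℤ}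
    (hℓ : IsCoprime ℓ (N : ℤ)) :
    HasSum (fun n : ℕ+ => ((∑ m ∈ divisorsCongr N ℓ n, m.sign : ℤ) : ℂ) *
        Complex.exp (2 * Real.pi * Complex.I * τ * (n : ℕ) / N))
      (((Int.fract ((ℓ : ℚ) / N) - 1 / 2 : ℚ) : ℂ) - lam / (2 * Real.pi * Complex.I) *
        heckeG' N (pairLattice lam τ) (lam * (ℓ * τ / N))) := by
  have : NeZero N := ⟨by omega⟩
  have h := hasSum_qExpansion hlam τ hN hℓ (a := 0) (ε := fun _ => 1) (by simp) (by simp)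
    (natCast_mul_mem_pairLattice lam τ ℓ)
  refine hasSum_of_eq h (fun n => by push_cast; simp) ?_
  congr 3
  push_cast
  ring

theorem hasSum_qExpansion_half {lam : ℂ} (hlam : lam ≠ 0) (τ : ℍ) {N : ℕ} (hN : 2 ≤ N)
    (hN2 : Even N) {ℓ : ℤ} (hℓ : IsCoprime ℓ (N : ℤ)) :
    HasSum (fun n : ℕ+ => ((∑ m ∈ divisorsCongr N ℓ n,
          (-1 : ℚ) ^ (((n : ℕ) : ℤ) / m) * (m.sign : ℚ) : ℚ) : ℂ) *
        Complex.exp (2 * Real.pi * Complex.I * τ * (n : ℕ) / N))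
      (((Int.fract ((ℓ : ℚ) / N) - 1 / 2 : ℚ) : ℂ) - lam / (2 * Real.pi * Complex.I) *
        heckeG' N (pairLattice lam τ) (lam * (1 / 2 + ℓ * τ / N))) := by
  have : NeZero N := ⟨by omega⟩
  have h := hasSum_qExpansion hlam τ hN hℓ (a := 1 / 2) (ε := fun d => (-1) ^ d)
    expTwoPiI_half_mul (fun d => by rw [zpow_neg, ← inv_zpow, inv_neg_one])
    (natCast_mul_mem_pairLattice_of_even lam τ hN2 ℓ)
  refine hasSum_of_eq h (fun n => by push_cast; rfl) ?_
  congr 3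
  push_cast
  ring

/-- The bases differ by the matrix of `τ ↦ -1/τ`, after `2πi / τ` is taken out as the scaling
factor. -/
theorem tateLattice_neg_inv (τ : ℍ) :
    tateLattice (-1 / (τ : ℂ)) = pairLattice (2 * Real.pi * Complex.I / τ) τ := by
  have hτ : (τ : ℂ) ≠ 0 := τ.ne_zero
  ext x
  change x ∈ pairLattice _ _ ↔ _
  rw [mem_pairLattice, mem_pairLattice]
  constructor
  · rintro ⟨v, rfl⟩
    refine ⟨(v.2, -v.1), ?_⟩
    simp only [latticePoint]
    push_cast
    field_simp
    ring
  · rintro ⟨v, rfl⟩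
    refine ⟨(-v.2, v.1), ?_⟩
    simp only [latticePoint]
    push_cast
    field_simp
    ring

end HeckeEisenstein

end

/-! ### The theorem -/

theorem proposition4p1 (N : ℕ) (hN : 2 ≤ N) (ℓ : ℤ) (hℓ : IsCoprime ℓ (N : ℤ)) :
    -- Hecke's continuation exists for all the series that enter
    (∀ (τ : ℍ) (w : ℂ), (N : ℂ) * w ∈ HeckeEisenstein.tateLattice τ →
      ∃ F, HeckeEisenstein.IsHeckeContinuation N (HeckeEisenstein.tateLattice τ) w F) ∧
    -- (a)
    (∀ τ : ℍ,
      Summable (fun n : ℕ+ =>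
        ((∑ m ∈ HeckeEisenstein.divisorsCongr N ℓ n, m.sign : ℤ) : ℂ) *
          Complex.exp (2 * Real.pi * Complex.I * τ * (n : ℕ) / N)) ∧
      HeckeEisenstein.heckeG' N (HeckeEisenstein.tateLattice τ)
          (2 * Real.pi * Complex.I * (ℓ * τ / N)) =
        (((Int.fract ((ℓ : ℚ) / N) - 1 / 2 : ℚ)) : ℂ) -
          ∑' n : ℕ+, ((∑ m ∈ HeckeEisenstein.divisorsCongr N ℓ n, m.sign : ℤ) : ℂ) *
            Complex.exp (2 * Real.pi * Complex.I * τ * (n : ℕ) / N)) ∧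
    -- (b)
    (Even N → ∀ τ : ℍ,
      Summable (fun n : ℕ+ =>
        ((∑ m ∈ HeckeEisenstein.divisorsCongr N ℓ n,
            (-1 : ℚ) ^ (((n : ℕ) : ℤ) / m) * (m.sign : ℚ) : ℚ) : ℂ) *
          Complex.exp (2 * Real.pi * Complex.I * τ * (n : ℕ) / N)) ∧
      HeckeEisenstein.heckeG' N (HeckeEisenstein.tateLattice τ)
          (2 * Real.pi * Complex.I * (1 / 2 + ℓ * τ / N)) =
        (((Int.fract ((ℓ : ℚ) / N) - 1 / 2 : ℚ)) : ℂ) -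
          ∑' n : ℕ+, ((∑ m ∈ HeckeEisenstein.divisorsCongr N ℓ n,
              (-1 : ℚ) ^ (((n : ℕ) : ℤ) / m) * (m.sign : ℚ) : ℚ) : ℂ) *
            Complex.exp (2 * Real.pi * Complex.I * τ * (n : ℕ) / N)) ∧
    -- the expansion at the cusp `τ = 0` of the weight one form
    -- `f(τ) = G'(ℤ·2πi + ℤ·2πiτ, 2πi ℓ / N)` has rational coefficients
    (∃ c : ℕ → ℚ, ∀ τ : ℍ,
      HasSum (fun n : ℕ => (c n : ℂ) * Complex.exp (2 * Real.pi * Complex.I * τ * n / N))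
        ((τ : ℂ)⁻¹ * HeckeEisenstein.heckeG' N (HeckeEisenstein.tateLattice (-1 / (τ : ℂ)))
          (2 * Real.pi * Complex.I * (ℓ / N)))) := by
  have : NeZero N := ⟨by omega⟩
  have hpi := Complex.two_pi_I_ne_zero
  refine ⟨fun τ w hw => ?_, fun τ => ?_, fun hN2 τ => ?_, ?_⟩
  · obtain ⟨F, hF⟩ := HeckeEisenstein.exists_isTwistedContinuation_of_torsion hpi τ hw
    exact ⟨F, hF.isHeckeContinuation hpi τ hw⟩
  · have h := HeckeEisenstein.hasSum_qExpansion_zero hpi τ hN hℓ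
    refine ⟨h.summable, ?_⟩
    rw [h.tsum_eq, div_self hpi, one_mul, sub_sub_cancel]
    rfl
  · have h := HeckeEisenstein.hasSum_qExpansion_half hpi τ hN hN2 hℓ
    refine ⟨h.summable, ?_⟩
    rw [h.tsum_eq, div_self hpi, one_mul, sub_sub_cancel]
    rfl
  · refine ⟨fun n => if n = 0 then Int.fract ((ℓ : ℚ) / N) - 1 / 2
      else -((∑ m ∈ HeckeEisenstein.divisorsCongr N ℓ n, m.sign : ℤ) : ℚ), fun τ => ?_⟩
    have hτ : (τ : ℂ) ≠ 0 := τ.ne_zero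
    -- With `lam = 2πi/τ` the prefactor `lam / (2πi)` is exactly the `τ⁻¹` of weight one, so the
    -- coefficients are those of (a).
    have h := (HeckeEisenstein.hasSum_qExpansion_zero (div_ne_zero hpi hτ) τ hN hℓ).neg
    rw [← hasSum_nat_add_iff' 1, ← Equiv.pnatEquivNat.hasSum_iff]
    refine HeckeEisenstein.hasSum_of_eq h (fun n => ?_) ?_
    · have hn : Equiv.pnatEquivNat n + 1 = (n : ℕ) := n.natPred_add_one
      simp only [Function.comp, hn, if_neg n.ne_zero]
      push_cast
      ring
    · rw [HeckeEisenstein.tateLattice_neg_inv]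
      have hu : 2 * (Real.pi : ℂ) * Complex.I / τ * (ℓ * τ / N) =
          2 * Real.pi * Complex.I * (ℓ / N) := by field_simp
      rw [hu, div_div, div_mul_eq_div_div_swap, div_self hpi]
      simp
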